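/- Let $\Gamma$ be a finite trivalent graph of genus $g$, not necessarily connected (loops and multiple edges allowed), with vertex set $V$, $|V|=2g-2$, and edge set $E$. Let $P=S^2\setminus(D_1\sqcup D_2\sqcup D_3)$ be the trinion (2-sphere minus three open discs with disjoint closures), and let $\Sigma_\Gamma$ be the closed oriented surface obtained by taking one trinion $P_v$ for each $v\in V$ and gluing boundary circles, by orientation-reversing homeomorphisms, along the edges of $\Gamma$; the circle corresponding to $e\in E$ is denoted $C_e$. For a space $X$ let $\operatorname{ClRep}(\pi_1(X))$ be the space of equivalence classes of representations of the fundamental groupoid of $X$ in $\operatorname{SU}(2)$ (homomorphisms $\pi_1(X)\to \operatorname{SU}(2)$ up to conjugacy if $X$ is path-connected), with the quotient of the topology of pointwise convergence. For a closed curve $C$ in $X$ put $c_C(\rho)=\frac1\pi\arccos\bigl(\frac12\operatorname{Tr}\rho([C])\bigr)\in[0,1]$. Let $c_\Gamma=(c_{C_e})_{e\in E}\colon \operatorname{ClRep}(\pi_1(\Sigma_\Gamma))\to\mathbb R^{E}$ and let the moment polytope $\Delta_\Gamma$ be its image. Let $\Theta$ be the graph with two vertices joined by three edges. Suppose that $\Gamma$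 is hyperbolic: $V=V_+\sqcup V_-$, and $\mathbb Z^{V_+}$ and $\mathbb Z^{V_-}$ are isotropic for the quadratic form on $\mathbb Z^V$ whose matrix entry at $(v,w)$ is the number of edges joining $v$ and $w$. Let $\Sigma_+=\bigcup_{v\in V_+}P_v\subset\Sigma_\Gamma$ be the half surface, and let $c_{\partial\Sigma_+}\colon\operatorname{ClRep}(\pi_1(\Sigma_+))\to\prod_{v\in V_+}\mathbb R^3$ be the map whose components are the functions $c_C$ for the three boundary circles $C$ of each $P_v$, $v\in V_+$. Then: 1. $\Delta_\Theta$ is the tetrahedron $\{t\in\mathbb R^3: 0\le t_i\le 1,\ |t_1-t_2|\le t_3\le\min(t_1+t_2,\,2-t_1-t_2)\}$. 2. $|V_+|=g-1$, and $E$ is the disjoint union of the triples $E(\Gamma)_v$ of edges at $v$, $v\in V_+$, so that $\mathbb R^E=\prod_{v\in V_+}\mathbb R^3$. 3. $c_{\partial\Sigma_+}$ is a homeomorphism (in particular a bijection) of $\operatorname{ClRep}(\pi_1(\Sigma_+))$ onto $\prod_{v\in V_+}\Delta_\Theta=(\Delta_\Theta)^{g-1}$. 4. Under the identification in 2, $\Delta_\Gamma$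 is contained in the image of $c_{\partial\Sigma_+}$, hence $\Delta_\Gamma\subset(\Delta_\Theta)^{g-1}$. -/

import Mathlib

/-- The group `SU(2)`, with the topology induced from `2 × 2` complex matrices. -/
abbrev SU2 : Type := Matrix.specialUnitaryGroup (Fin 2) ℂ

section Representations

open CategoryTheory

universe u

/-- A representation of `π₁(X)` in `SU(2)`. As `X` need not be connected, `π₁(X)` is the
fundamental groupoid, and a representation is a functor from it to the group `SU(2)`
(regarded as a category with one object). -/
def SU2Rep (X : Type u) [TopologicalSpace X] : Type u :=
  FundamentalGroupoid X ⥤ SingleObj SU2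

/-- The value (holonomy) in `SU(2)` of a representation on the homotopy class of a path. -/
noncomputable def SU2Rep.hol {X : Type u} [TopologicalSpace X] (ρ : SU2Rep X) {x y : FundamentalGroupoid X}
    (γ : x ⟶ y) : SU2 :=
  CategoryTheory.Functor.map (C := FundamentalGroupoid X) (D := SingleObj SU2) ρ γ

/-- The topology of pointwise convergence on representations. -/
noncomputable instance SU2Rep.topologicalSpace (X : Type u) [TopologicalSpace X] : TopologicalSpace (SU2Rep X) :=
  TopologicalSpace.induced
    (fun (ρ : SU2Rep X) (γ : Σ x y : FundamentalGroupoid X, (x ⟶ y)) => ρ.hol γ.2.2)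
    Pi.topologicalSpace

/-- Two representations are equivalent if they are naturally isomorphic; for path-connected `X`
this is conjugacy of homomorphisms from the fundamental group. -/
noncomputable def SU2Rep.setoid (X : Type u) [TopologicalSpace X] : Setoid (SU2Rep X) :=
  isIsomorphicSetoid (FundamentalGroupoid X ⥤ SingleObj SU2)

/-- The space `ClRep(π₁(X))` of classes of `SU(2)`-representations. -/
def ClRep (X : Type u) [TopologicalSpace X] : Type u := Quotient (SU2Rep.setoid X)

noncomputable instance ClRep.topologicalSpace (X : Type u) [TopologicalSpace X] : TopologicalSpace (ClRep X) :=
  inferInstanceAs (TopologicalSpace (Quotient (SU2Rep.setoid X)))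

/-- The homotopy class of a path, as a morphism of the fundamental groupoid. -/
def pathClass {X : Type u} [TopologicalSpace X] {x y : X} (γ : Path x y) :
    FundamentalGroupoid.mk x ⟶ FundamentalGroupoid.mk y :=
  FundamentalGroupoid.fromPath (Path.Homotopic.Quotient.mk γ)

/-- The Goldman function `π⁻¹ arccos (½ Tr ρ([C]))` of a closed curve `C`, on representations.
(Traces of elements of `SU(2)` are real.) -/
noncomputable def SU2Rep.goldman {X : Type u} [TopologicalSpace X] {x : X} (C : Path x x)
    (ρ : SU2Rep X) : ℝ :=
  1 / Real.pi *
    Real.arccos (1 / 2 * (Matrix.trace (ρ.hol (pathClass C) : Matrix (Fin 2) (Fin 2) ℂ)).re)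

theorem SU2Rep.goldman_congr {X : Type u} [TopologicalSpace X] {x : X} (C : Path x x)
    (ρ σ : SU2Rep X) (h : (SU2Rep.setoid X).r ρ σ) : ρ.goldman C = σ.goldman C := by
  obtain ⟨φ⟩ := h
  let f : FundamentalGroupoid.mk x ⟶ FundamentalGroupoid.mk x := pathClass C
  let g : SU2 := NatTrans.app φ.hom (FundamentalGroupoid.mk x)
  have key : g * ρ.hol f = σ.hol f * g := φ.hom.naturality f
  have e : ρ.hol f = g⁻¹ * (σ.hol f * g) := by rw [← key]; group
  have tr : Matrix.trace (ρ.hol f : Matrix (Fin 2) (Fin 2) ℂ)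
      = Matrix.trace (σ.hol f : Matrix (Fin 2) (Fin 2) ℂ) := by
    rw [e, Submonoid.coe_mul, Matrix.trace_mul_comm, ← Submonoid.coe_mul]
    congr 2
    group
  change 1 / Real.pi * Real.arccos (1 / 2 * (Matrix.trace
    (ρ.hol f : Matrix (Fin 2) (Fin 2) ℂ)).re) = _
  rw [tr]
  rfl

/-- The Goldman function `c_C : ClRep(π₁(X)) → [0, 1] ⊂ ℝ`. -/
noncomputable def ClRep.goldman {X : Type u} [TopologicalSpace X] {x : X} (C : Path x x) :
    ClRep X → ℝ :=
  Quotient.lift (SU2Rep.goldman C) (SU2Rep.goldman_congr C)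

end Representations

section Trinion

/-- The trinion `S² ∖ (D₁ ∪ D₂ ∪ D₃)`, where `S² = ℂ ∪ {∞}` and the three deleted disjoint open
discs are `|z| > 4` (with `∞`), `|z - 2| < 1` and `|z + 2| < 1`. -/
def Trinion : Type := {z : ℂ // ‖z‖ ≤ 4 ∧ 1 ≤ ‖z - 2‖ ∧ 1 ≤ ‖z + 2‖}

instance Trinion.topologicalSpace : TopologicalSpace Trinion :=
  inferInstanceAs (TopologicalSpace {z : ℂ // ‖z‖ ≤ 4 ∧ 1 ≤ ‖z - 2‖ ∧ 1 ≤ ‖z + 2‖})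

/-- Parametrization of the `i`-th boundary circle. All three circles carry the boundary
orientation: the outer one is counterclockwise, the inner two are clockwise. -/
noncomputable def circlePoint (i : Fin 3) (θ : ℝ) : ℂ :=
  (![0, 2, -2] i : ℂ) +
    ((![4, 1, 1] i : ℝ) : ℂ) * Complex.exp (((![1, -1, -1] i * θ : ℝ) : ℂ) * Complex.I)

theorem circlePoint_mem (i : Fin 3) (θ : ℝ) :
    ‖circlePoint i θ‖ ≤ 4 ∧ 1 ≤ ‖circlePoint i θ - 2‖ ∧ 1 ≤ ‖circlePoint i θ + 2‖ := by
  have n2 : ‖(2 : ℂ)‖ = 2 := by norm_num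
  have n4 : ‖(4 : ℂ)‖ = 4 := by norm_num
  fin_cases i
  · have h : ‖(4 : ℂ) * Complex.exp ((θ : ℂ) * Complex.I)‖ = 4 := by
      rw [norm_mul, Complex.norm_exp_ofReal_mul_I, n4, mul_one]
    have e : circlePoint 0 θ = 4 * Complex.exp ((θ : ℂ) * Complex.I) := by
      simp [circlePoint]
    have h1 := norm_sub_norm_le (4 * Complex.exp ((θ : ℂ) * Complex.I)) 2
    have h2 := norm_sub_le_norm_add (4 * Complex.exp ((θ : ℂ) * Complex.I)) 2
    change ‖circlePoint 0 θ‖ ≤ 4 ∧ 1 ≤ ‖circlePoint 0 θ - 2‖ ∧ 1 ≤ ‖circlePoint 0 θ + 2‖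
    rw [e]
    exact ⟨h.le, by linarith, by linarith⟩
  · set w : ℂ := Complex.exp (((-θ : ℝ) : ℂ) * Complex.I) with hw
    have h : ‖w‖ = 1 := Complex.norm_exp_ofReal_mul_I _
    have e : circlePoint 1 θ = 2 + w := by simp [circlePoint, hw]
    have h1 := norm_add_le 2 w
    have h2 := norm_sub_le_norm_add 4 w
    change ‖circlePoint 1 θ‖ ≤ 4 ∧ 1 ≤ ‖circlePoint 1 θ - 2‖ ∧ 1 ≤ ‖circlePoint 1 θ + 2‖
    rw [e]
    refine ⟨by linarith, ?_, ?_⟩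
    · rw [show 2 + w - 2 = w by ring, h]
    · rw [show 2 + w + 2 = 4 + w by ring]; linarith
  · set w : ℂ := Complex.exp (((-θ : ℝ) : ℂ) * Complex.I) with hw
    have h : ‖w‖ = 1 := Complex.norm_exp_ofReal_mul_I _
    have e : circlePoint 2 θ = -2 + w := by simp [circlePoint, hw]
    have h1 := norm_sub_le w 2
    have h2 := norm_sub_norm_le 4 w
    change ‖circlePoint 2 θ‖ ≤ 4 ∧ 1 ≤ ‖circlePoint 2 θ - 2‖ ∧ 1 ≤ ‖circlePoint 2 θ + 2‖
    rw [e]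
    refine ⟨?_, ?_, ?_⟩
    · rw [show -2 + w = w - 2 by ring]; linarith
    · rw [show -2 + w - 2 = -(4 - w) by ring, norm_neg]; linarith
    · rw [show -2 + w + 2 = w by ring, h]

theorem continuous_circlePoint (i : Fin 3) : Continuous (circlePoint i) := by
  unfold circlePoint
  fun_prop

theorem circlePoint_two_pi (i : Fin 3) : circlePoint i (2 * Real.pi) = circlePoint i 0 := by
  fin_cases i
  · simp [circlePoint]
  all_goals simp [circlePoint, Complex.exp_neg]

/-- The point with parameter `θ` on the `i`-th boundary circle of the trinion. -/
noncomputable def Trinion.boundary (i : Fin 3) (θ : ℝ) : Trinion :=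
  ⟨circlePoint i θ, circlePoint_mem i θ⟩

theorem Trinion.continuous_boundary (i : Fin 3) : Continuous (Trinion.boundary i) :=
  Continuous.subtype_mk (continuous_circlePoint i) _

/-- The `i`-th boundary circle of the trinion, as a closed path traversed once. -/
noncomputable def Trinion.boundaryLoop (i : Fin 3) :
    Path (Trinion.boundary i 0) (Trinion.boundary i 0) where
  toFun t := Trinion.boundary i (2 * Real.pi * (t : ℝ))
  continuous_toFun := (Trinion.continuous_boundary i).comp (by fun_prop)
  source' := by simp
  target' := Subtype.ext (by simpa [Trinion.boundary] using circlePoint_two_pi i)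

/-- The tetrahedron `0 ≤ tᵢ ≤ 1`, `|t₁ - t₂| ≤ t₃ ≤ min (t₁ + t₂, 2 - t₁ - t₂)` in `ℝ³`. -/
def tetrahedron : Set (Fin 3 → ℝ) :=
  {t | (∀ i, 0 ≤ t i ∧ t i ≤ 1) ∧ |t 0 - t 1| ≤ t 2 ∧ t 2 ≤ min (t 0 + t 1) (2 - t 0 - t 1)}

end Trinion

/-- A trivalent graph with vertices `V` and edges `E`; multiple edges, loops and several
components are allowed. Every edge `e` has two half-edges `(e, false)`, `(e, true)`, every vertex
`v` has three ends `(v, 0)`, `(v, 1)`, `(v, 2)`, and half-edges and ends are matched bijectively. -/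
structure TrivalentGraph (V E : Type*) where
  /-- the end at which a half-edge is attached -/
  halfEdge : E × Bool ≃ V × Fin 3

namespace TrivalentGraph

universe u v

variable {V : Type u} {E : Type v} (Γ : TrivalentGraph V E)

/-- The edge that leaves the vertex `v` at its `i`-th end. -/
def edge (v : V) (i : Fin 3) : E := (Γ.halfEdge.symm (v, i)).1

/-- The vertex at which a half-edge is attached. -/
def endpoint (h : E × Bool) : V := (Γ.halfEdge h).1

/-- The matrix `q_Γ`, whose entry at `(v, w)` is the number of edges joining `v` and `w`. -/
noncomputable def incidence : Matrix V V ℤ :=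
  Matrix.of fun v w =>
    (Set.ncard {e : E | s(Γ.endpoint (e, false), Γ.endpoint (e, true)) = s(v, w)} : ℤ)

/-- `ℤ^S` is isotropic with respect to the quadratic form `q_Γ`. -/
def IsIsotropic [Fintype V] (S : Set V) : Prop :=
  ∀ x : V → ℤ, (∀ v, v ∉ S → x v = 0) → dotProduct x (Matrix.mulVec Γ.incidence x) = 0

/-- `V₊` and `V₋` exhibit `Γ` as a hyperbolic graph: they partition the vertices, and `ℤ^{V₊}` and
`ℤ^{V₋}` are isotropic. -/
structure IsHyperbolic [Fintype V] (Vplus Vminus : Set V) : Prop where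
  isCompl : IsCompl Vplus Vminus
  isotropic_plus : Γ.IsIsotropic Vplus
  isotropic_minus : Γ.IsIsotropic Vminus

/-- The gluing of the trinions: for every edge, the two boundary circles at its ends are identified
by a homeomorphism that reverses the boundary orientations. -/
inductive Glue : (Σ _ : V, Trinion) → (Σ _ : V, Trinion) → Prop
  | glue (e : E) (θ : ℝ) :
      Glue ⟨(Γ.halfEdge (e, false)).1, Trinion.boundary (Γ.halfEdge (e, false)).2 θ⟩
        ⟨(Γ.halfEdge (e, true)).1, Trinion.boundary (Γ.halfEdge (e, true)).2 (-θ)⟩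

/-- The closed surface `Σ_Γ`: one trinion for every vertex, glued along the edges. -/
def Surface : Type u := Quot Γ.Glue

instance Surface.topologicalSpace : TopologicalSpace Γ.Surface :=
  inferInstanceAs (TopologicalSpace (Quot Γ.Glue))

/-- The map of the trinion of the vertex `v` to the surface `Σ_Γ`. -/
def trinionMap (v : V) (z : Trinion) : Γ.Surface := Quot.mk Γ.Glue ⟨v, z⟩

theorem continuous_trinionMap (v : V) : Continuous (Γ.trinionMap v) :=
  continuous_quot_mk.comp (continuous_sigmaMk (σ := fun _ : V => Trinion))

/-- The circle `C_e` on `Σ_Γ` (up to orientation): the image of a boundary circle at an end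
of `e`. -/
noncomputable def meridian (e : E) :
    Path (Γ.trinionMap (Γ.halfEdge (e, false)).1 (Trinion.boundary (Γ.halfEdge (e, false)).2 0))
      (Γ.trinionMap (Γ.halfEdge (e, false)).1 (Trinion.boundary (Γ.halfEdge (e, false)).2 0)) :=
  (Trinion.boundaryLoop (Γ.halfEdge (e, false)).2).map
    (Γ.continuous_trinionMap (Γ.halfEdge (e, false)).1)

/-- The moment map `c_Γ : ClRep(π₁(Σ_Γ)) → ℝ^E`, `c_Γ(ρ)_e = c_{C_e}(ρ)`. -/
noncomputable def momentMap (ρ : ClRep Γ.Surface) : E → ℝ := fun e => ρ.goldman (Γ.meridian e)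

/-- The moment polytope `Δ_Γ`, the image of `c_Γ`. -/
def momentPolytope : Set (E → ℝ) := Set.range Γ.momentMap

/-- The half surface `Σ₊ ⊂ Σ_Γ`: the union of the trinions of the vertices in `V₊`. -/
def halfSurface (Vplus : Set V) : Set Γ.Surface :=
  ⋃ v ∈ Vplus, Set.range (Γ.trinionMap v)

/-- The map of the trinion of a vertex in `V₊` to `Σ₊`. -/
def halfTrinionMap (Vplus : Set V) (v : Vplus) (z : Trinion) : Γ.halfSurface Vplus :=
  ⟨Γ.trinionMap v z, Set.mem_biUnion v.2 ⟨z, rfl⟩⟩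

theorem continuous_halfTrinionMap (Vplus : Set V) (v : Vplus) :
    Continuous (Γ.halfTrinionMap Vplus v) :=
  (Γ.continuous_trinionMap (v : V)).subtype_mk _

/-- The boundary holonomy map `c_{∂Σ₊} : ClRep(π₁(Σ₊)) → ∏_{v ∈ V₊} ℝ³`, given by the Goldman
functions of the boundary circles of the trinions in `Σ₊`. -/
noncomputable def boundaryHolonomy (Vplus : Set V) (ρ : ClRep (Γ.halfSurface Vplus)) :
    Vplus → Fin 3 → ℝ :=
  fun v i => ρ.goldman
    ((Trinion.boundaryLoop i).map (Γ.continuous_halfTrinionMap Vplus v))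

/-- The coordinates on `ℝ^E` grouped by the vertices in `V₊`: the map
`ℝ^E → ∏_{v ∈ V₊} ℝ³`, `t ↦ (t_e)_{e ∈ E(Γ)_v}`. -/
def groupCoords (Vplus : Set V) (t : E → ℝ) : Vplus → Fin 3 → ℝ := fun v i => t (Γ.edge v i)

/-- The graph `Θ`: two vertices joined by three edges. -/
def theta : TrivalentGraph Bool (Fin 3) where
  halfEdge := Equiv.prodComm (Fin 3) Bool

end TrivalentGraph

/-- The product `(Δ_Θ)^{V₊}` of copies of the moment polytope `Δ_Θ` of the graph `Θ`. -/
def thetaProduct {V : Type*} (Vplus : Set V) : Set (Vplus → Fin 3 → ℝ) :=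
  Set.pi Set.univ fun _ => TrivalentGraph.theta.momentPolytope

/-! Up to gauge equivalence a representation of the trinion is a pair `(A, C)` in SU(2), the
holonomies of the two inner boundary circles; the outer circle then has holonomy `(C * A)⁻¹`
(`exists_intertwines_rep`, `rep_along_zero`). Diagonalise `A` with eigenvalues `exp (± i θ)`, and
let `(p, q)` be the first row of `C` in this basis. The angle of `C` gives `Re p`, and the cosine of
the angle of `C * A` is `Re p cos θ - Im p sin θ`. If `sin θ ≠ 0`, the three angles therefore fix
`p` and `|q|`, and the phase of `q` is removed by a diagonal conjugation; if `sin θ = 0`, `A` is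
central. So the angles separate classes (`exists_simultaneous_conj`). As `|Im p| ≤ sin (angle C)`,
and all such values occur, the third angle is restricted exactly by the spherical triangle
inequalities (`angle_mul_triangle`, `exists_angles`), which become the tetrahedron after division by
`π`.

The surface of `Θ` is the double of a trinion and folds onto it, so every trinion representation
extends and `Δ_Θ` is the tetrahedron.

Isotropy, tested on the indicator vector of `V₊` or `V₋`, forbids edges inside that set. Every edge
thus has exactly one end on each side; this gives the counts, and makes `Σ₊` a disjoint union of
trinions (`exists_halfSurface_homeomorph`). So `c_{∂Σ₊}` is a continuous bijection onto the product
of tetrahedra. Its source is compact, being a quotient of a closed subset of a power of SU(2), and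
its target is Hausdorff: it is a homeomorphism. For the last claim, restrict a representation of
`Σ_Γ` to `Σ₊`; the two sides of a glued circle have inverse holonomies, hence equal angles. -/

section Holonomy

open CategoryTheory Topology

universe u v w

variable {X : Type u} [TopologicalSpace X]

/-! ### Representations of the fundamental groupoid as holonomies along paths. -/

namespace SU2Rep

/-- The holonomy of a representation along a path. -/
noncomputable def along (ρ : SU2Rep X) {x y : X} (γ : Path x y) : SU2 := ρ.hol (pathClass γ)

theorem along_congr (ρ : SU2Rep X) {x y : X} {γ δ : Path x y} (h : γ.Homotopic δ) :
    ρ.along γ = ρ.along δ := by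
  have e : pathClass γ = pathClass δ := Quotient.sound h
  rw [along, along, e]

theorem along_refl (ρ : SU2Rep X) (x : X) : ρ.along (Path.refl x) = 1 :=
  CategoryTheory.Functor.map_id (C := FundamentalGroupoid X) (D := SingleObj SU2) ρ (FundamentalGroupoid.mk x)

/-- Composition in `SingleObj SU2` is multiplication in reversed order, so the later path stands on
the left. -/
theorem along_trans (ρ : SU2Rep X) {x y z : X} (γ : Path x y) (δ : Path y z) :
    ρ.along (γ.trans δ) = ρ.along δ * ρ.along γ :=
  CategoryTheory.Functor.map_comp (C := FundamentalGroupoid X) (D := SingleObj SU2) ρ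
    (pathClass γ) (pathClass δ)

theorem along_symm (ρ : SU2Rep X) {x y : X} (γ : Path x y) :
    ρ.along γ.symm = (ρ.along γ)⁻¹ := by
  rw [eq_inv_iff_mul_eq_one, ← along_trans, ρ.along_congr (Path.Homotopic.trans_symm γ),
    along_refl]

theorem along_cast (ρ : SU2Rep X) {x y x' y' : X} (γ : Path x y) (hx : x' = x) (hy : y' = y) :
    ρ.along (γ.cast hx hy) = ρ.along γ := by
  subst hx hy
  rfl

theorem exists_eq_pathClass {x y : FundamentalGroupoid X} (γ : x ⟶ y) :
    ∃ δ : Path x.as y.as, γ = pathClass δ := by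
  obtain ⟨δ, hδ⟩ := Path.Homotopic.Quotient.mk_surjective (X := X) γ
  exact ⟨δ, hδ.symm⟩

/-- A representation given by its holonomies along paths. -/
noncomputable def ofPaths (h : ∀ {x y : X}, Path x y → SU2)
    (homotopic : ∀ {x y : X} (γ δ : Path x y), γ.Homotopic δ → h γ = h δ)
    (refl : ∀ x : X, h (Path.refl x) = 1)
    (trans : ∀ {x y z : X} (γ : Path x y) (δ : Path y z), h (γ.trans δ) = h δ * h γ) :
    SU2Rep X where
  obj _ := SingleObj.star SU2
  map {x y} γ := Quotient.lift (s := Path.Homotopic.setoid x.as y.as) (fun δ => h δ)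
    (fun δ ε hd => homotopic δ ε hd) γ
  map_id x := refl x.as
  map_comp := by
    rintro x y z ⟨γ⟩ ⟨δ⟩
    exact trans γ δ

theorem ofPaths_along (h : ∀ {x y : X}, Path x y → SU2) (h1 h2 h3) {x y : X} (γ : Path x y) :
    (ofPaths (X := X) h h1 h2 h3).along γ = h γ := rfl

/-- The pullback of a representation along a continuous map. -/
noncomputable def pullback {Y : Type v} [TopologicalSpace Y] (f : C(Y, X)) (ρ : SU2Rep X) :
    SU2Rep Y :=
  Functor.comp (C := FundamentalGroupoid Y) (D := FundamentalGroupoid X) (E := SingleObj SU2)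
    (FundamentalGroupoid.map f) ρ

theorem pullback_along {Y : Type v} [TopologicalSpace Y] (f : C(Y, X)) (ρ : SU2Rep X) {x y : Y}
    (γ : Path x y) : (ρ.pullback f).along γ = ρ.along (γ.map f.continuous) := rfl

/-- A gauge transformation on `X` that intertwines two representations. -/
def Intertwines (ρ σ : SU2Rep X) (h : X → SU2) : Prop :=
  ∀ ⦃x y : X⦄ (γ : Path x y), h y * ρ.along γ = σ.along γ * h x

theorem setoid_iff (ρ σ : SU2Rep X) :
    (SU2Rep.setoid X).r ρ σ ↔ ∃ h : X → SU2, Intertwines ρ σ h := by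
  constructor
  · rintro ⟨φ⟩
    exact ⟨fun x => NatTrans.app φ.hom (FundamentalGroupoid.mk x),
      fun x y γ => φ.hom.naturality (pathClass γ)⟩
  · rintro ⟨h, hh⟩
    refine ⟨NatIso.ofComponents
      (fun x => ⟨h x.as, ((h x.as)⁻¹ : SU2), ?_, ?_⟩) ?_⟩
    · exact inv_mul_cancel (h x.as)
    · exact mul_inv_cancel (h x.as)
    · intro x y γ
      obtain ⟨δ, rfl⟩ := exists_eq_pathClass γ
      exact hh δ

theorem mk_eq_iff (ρ σ : SU2Rep X) :
    ((Quotient.mk _ ρ : ClRep X) = Quotient.mk _ σ) ↔ ∃ h : X → SU2, Intertwines ρ σ h := by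
  rw [← setoid_iff]
  exact Quotient.eq (r := SU2Rep.setoid X)

theorem Intertwines.trans {ρ σ τ : SU2Rep X} {h k : X → SU2} (hh : Intertwines ρ σ h)
    (hk : Intertwines σ τ k) : Intertwines ρ τ (fun x => k x * h x) := by
  intro x y γ
  rw [mul_assoc, hh γ, ← mul_assoc, hk γ, mul_assoc]

theorem Intertwines.symm {ρ σ : SU2Rep X} {h : X → SU2} (hh : Intertwines ρ σ h) :
    Intertwines σ ρ (fun x => (h x)⁻¹) := by
  intro x y γ
  have := hh γ
  rw [inv_mul_eq_iff_eq_mul, ← mul_assoc, this, mul_inv_cancel_right]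

theorem Intertwines.pullback {Y : Type v} [TopologicalSpace Y] {ρ σ : SU2Rep X} {h : X → SU2}
    (hh : Intertwines ρ σ h) (f : C(Y, X)) :
    Intertwines (ρ.pullback f) (σ.pullback f) (h ∘ f) :=
  fun _ _ γ => hh (γ.map f.continuous)

/-- Serves to transfer classifications: a retract inherits them from the larger space without any
homotopy equivalence, and homeomorphic spaces from each other. -/
theorem intertwines_pullback_of_leftInverse {Y : Type v} [TopologicalSpace Y] (f : C(Y, X))
    (g : C(X, Y)) (hfg : ∀ x, f (g x) = x) (ρ : SU2Rep X) :
    Intertwines ρ ((ρ.pullback f).pullback g) fun _ => 1 := by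
  intro x y γ
  rw [one_mul, mul_one, pullback_along, pullback_along,
    ← ρ.along_cast ((γ.map g.continuous).map f.continuous) (hfg x).symm (hfg y).symm]
  congr 1
  ext t
  exact (hfg (γ t)).symm

/-- Paths generate: a property of paths that is stable under homotopy, composition and change of
names of the end points holds for all paths if it holds for those inside the sets of an open
cover. -/
theorem path_induction {ι : Type w} {c : ι → Set X} (hc : ∀ i, IsOpen (c i))
    (hcover : ∀ x, ∃ i, x ∈ c i) {P : ∀ x y : X, Path x y → Prop}
    (homotopic : ∀ x y (γ δ : Path x y), γ.Homotopic δ → P x y γ → P x y δ)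
    (trans : ∀ x y z (γ : Path x y) (δ : Path y z), P x y γ → P y z δ → P x z (γ.trans δ))
    (small : ∀ i x y (γ : Path x y), (∀ t, γ t ∈ c i) → P x y γ) {x y : X} (γ : Path x y) :
    P x y γ := by
  obtain ⟨t, t0, tm, ⟨n, hn⟩, ht⟩ :=
    exists_monotone_Icc_subset_open_cover_unitInterval (c := fun i => γ ⁻¹' c i)
      (fun i => (hc i).preimage γ.continuous)
      (fun s _ => by simpa using hcover (γ s))
  have key : ∀ m, P _ _ (γ.subpath 0 (t m)) := by
    intro m
    induction m with
    | zero =>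
      obtain ⟨i, hi⟩ := hcover (γ 0)
      rw [t0]
      refine small i _ _ _ fun s => ?_
      simpa using hi
    | succ m ih =>
      obtain ⟨i, hi⟩ := ht m
      refine homotopic _ _ _ _ ⟨Path.Homotopy.subpathTransSubpath γ 0 (t m) (t (m + 1))⟩
        (trans _ _ _ _ _ ih (small i _ _ _ fun s => ?_))
      have hs : γ.subpath (t m) (t (m + 1)) s ∈ Set.range (γ.subpath (t m) (t (m + 1))) := ⟨s, rfl⟩
      rw [Path.range_subpath_of_le _ _ _ (tm (Nat.le_succ m))] at hs
      obtain ⟨r, hr, e⟩ := hs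
      rw [← e]
      exact hi hr
  have h1 := key n
  rw [hn n le_rfl, Path.subpath_zero_one] at h1
  -- The subpath from 0 to 1 is `γ` only up to a cast of its end points.
  have gen : ∀ {a b a' b' : X} (ha : a' = a) (hb : b' = b) (δ : Path a b),
      P a' b' (δ.cast ha hb) → P a b δ := by
    intro a b a' b' ha hb δ h
    subst ha hb
    exact h
  exact gen _ _ γ h1

theorem intertwines_of_cover {ι : Type w} {c : ι → Set X} (hc : ∀ i, IsOpen (c i))
    (hcover : ∀ x, ∃ i, x ∈ c i) (ρ σ : SU2Rep X) (h : X → SU2)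
    (small : ∀ i x y (γ : Path x y), (∀ t, γ t ∈ c i) → h y * ρ.along γ = σ.along γ * h x) :
    Intertwines ρ σ h := by
  intro x y γ
  refine path_induction hc hcover (P := fun x y γ => h y * ρ.along γ = σ.along γ * h x)
    ?_ ?_ small γ
  · intro x y γ δ hd e
    rwa [← ρ.along_congr hd, ← σ.along_congr hd]
  · intro x y z γ δ e1 e2
    rw [along_trans, along_trans, ← mul_assoc, e2, mul_assoc, e1, mul_assoc]

end SU2Rep

end Holonomy

/-! ### Parallel transport of a local cocycle. -/

section Transport

open Topology unitInterval Filter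

universe u w

variable {X : Type u} {G : Type w} [Group G]

/-- `φ` is a cocycle on the set `W`. -/
def IsCocycleOn (φ : X → X → G) (W : Set X) : Prop :=
  ∀ a ∈ W, ∀ b ∈ W, ∀ c ∈ W, φ b c * φ a b = φ a c

theorem IsCocycleOn.self {φ : X → X → G} {W : Set X} (h : IsCocycleOn φ W) {x : X} (hx : x ∈ W) :
    φ x x = 1 := by
  simpa using h x hx x hx x hx

/-- `u` is parallel along the curve `γ` with respect to `φ`. -/
def IsTransport (φ : X → X → G) (γ : I → X) (u : I → G) : Prop :=
  ∀ t, ∀ᶠ s in 𝓝 t, u s = φ (γ t) (γ s) * u t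

theorem IsTransport.comp {φ : X → X → G} {γ : I → X} {u : I → G} (hu : IsTransport φ γ u)
    {f : I → I} (hf : Continuous f) : IsTransport φ (γ ∘ f) (u ∘ f) :=
  fun t => (hf.tendsto t).eventually (hu (f t))

/-- The quotient `v⁻¹ u` is locally constant on the connected interval. -/
theorem IsTransport.unique {φ : X → X → G} {γ : I → X} {u v : I → G} (hu : IsTransport φ γ u)
    (hv : IsTransport φ γ v) (s t : I) : u s * (u t)⁻¹ = v s * (v t)⁻¹ := by
  have hc : IsLocallyConstant fun r => (v r)⁻¹ * u r := by
    rw [IsLocallyConstant.iff_eventually_eq]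
    intro r
    filter_upwards [hu r, hv r] with q h1 h2
    rw [h1, h2]
    group
  have := hc.apply_eq_of_isPreconnected isPreconnected_univ (Set.mem_univ s) (Set.mem_univ t)
  rw [inv_mul_eq_iff_eq_mul] at this
  rw [this]
  group

variable [TopologicalSpace X]

/-- Every point has a neighbourhood on which `φ` is a cocycle. -/
def IsLocalCocycle (φ : X → X → G) : Prop :=
  ∀ x, ∃ W, IsOpen W ∧ x ∈ W ∧ IsCocycleOn φ W

theorem IsLocalCocycle.self {φ : X → X → G} (h : IsLocalCocycle φ) (x : X) : φ x x = 1 := by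
  obtain ⟨W, -, hx, hW⟩ := h x
  exact hW.self hx

theorem IsLocalCocycle.exists_transport {φ : X → X → G} (h : IsLocalCocycle φ) {γ : I → X}
    (hγ : Continuous γ) : ∃ u, IsTransport φ γ u := by
  choose W hWo hxW hW using h
  obtain ⟨t, t0, tm, ⟨n, hn⟩, ht⟩ :=
    exists_monotone_Icc_subset_open_cover_unitInterval (c := fun x => γ ⁻¹' W x)
      (fun x => (hWo x).preimage hγ) (fun s _ => Set.mem_iUnion.2 ⟨γ s, hxW (γ s)⟩)
  -- At stage `m`, `u` is required to be parallel on `[0, t m]` only; its later values are arbitrary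
  -- and are replaced at the next stage.
  have key : ∀ m, ∃ u : I → G, ∀ r ≤ t m, ∀ᶠ s in 𝓝 r, s ≤ t m → u s = φ (γ r) (γ s) * u r := by
    intro m
    induction m with
    | zero =>
      refine ⟨fun _ => 1, fun r hr => Eventually.of_forall fun s hs => ?_⟩
      rw [t0] at hr hs
      have hr' : r = 0 := le_antisymm hr bot_le
      have hs' : s = 0 := le_antisymm hs bot_le
      rw [hr', hs', (hW (γ 0)).self (hxW _), mul_one]
    | succ m ih =>
      obtain ⟨u, hu⟩ := ih
      obtain ⟨x, hx⟩ := ht m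
      have hm : t m ∈ Set.Icc (t m) (t (m + 1)) := ⟨le_rfl, tm (Nat.le_succ m)⟩
      refine ⟨fun s => if s ≤ t m then u s else φ (γ (t m)) (γ s) * u (t m), fun r hr => ?_⟩
      rcases lt_trichotomy r (t m) with hlt | heq | hgt
      · filter_upwards [hu r hlt.le, gt_mem_nhds hlt] with s hs hs' _
        rw [if_pos hs'.le, if_pos hlt.le, hs hs'.le]
      · subst heq
        filter_upwards [hu (t m) le_rfl] with s hs _
        by_cases h' : s ≤ t m
        · rw [if_pos h', if_pos le_rfl, hs h']
        · rw [if_neg h', if_pos le_rfl]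
      · filter_upwards [lt_mem_nhds hgt] with s hs hs'
        rw [if_neg hs.not_ge, if_neg hgt.not_ge, ← mul_assoc,
          hW x _ (hx hm) _ (hx ⟨hgt.le, hr⟩) _ (hx ⟨hs.le, hs'⟩)]
  obtain ⟨u, hu⟩ := key n
  rw [hn n le_rfl] at hu
  exact ⟨u, fun r => (hu r le_top).mono fun s hs => hs le_top⟩

/-- The holonomy of the curve `H s` is locally constant in `s`: a transport along one curve,
corrected by `φ` between corresponding points, is a transport along any sufficiently close curve.
The correction is trivial at the fixed end points. -/
theorem IsLocalCocycle.transport_homotopy {φ : X → X → G} (h : IsLocalCocycle φ)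
    {H : I → I → X} (hH : Continuous fun p : I × I => H p.1 p.2)
    (h0 : ∀ s, H s 0 = H 0 0) (h1 : ∀ s, H s 1 = H 0 1) {u v : I → G}
    (hu : IsTransport φ (H 0) u) (hv : IsTransport φ (H 1) v) :
    u 1 * (u 0)⁻¹ = v 1 * (v 0)⁻¹ := by
  have hc : ∀ s, Continuous (H s) := fun s => hH.comp (by fun_prop : Continuous fun t => (s, t))
  choose w hw using fun s => h.exists_transport (hc s)
  have hloc : IsLocallyConstant fun s => w s 1 * (w s 0)⁻¹ := by
    rw [IsLocallyConstant.iff_eventually_eq]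
    intro s₀
    -- Compactness of the interval makes closeness of the two curves uniform in `t`.
    have hev : ∀ᶠ s in 𝓝 s₀, ∀ t ∈ (Set.univ : Set I),
        ∃ W, IsOpen W ∧ IsCocycleOn φ W ∧ H s₀ t ∈ W ∧ H s t ∈ W := by
      refine isCompact_univ.eventually_forall_of_forall_eventually fun t _ => ?_
      obtain ⟨W, hWo, hxW, hW⟩ := h (H s₀ t)
      have e1 : ∀ᶠ p : I × I in 𝓝 (s₀, t), H p.1 p.2 ∈ W :=
        hH.continuousAt.eventually (hWo.mem_nhds hxW)
      have e2 : ∀ᶠ p : I × I in 𝓝 (s₀, t), H s₀ p.2 ∈ W :=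
        (hc s₀ |>.comp continuous_snd).continuousAt.eventually (hWo.mem_nhds hxW)
      filter_upwards [e1, e2] with p p1 p2
      exact ⟨W, hWo, hW, p2, p1⟩
    filter_upwards [hev] with s hs
    have hv : IsTransport φ (H s) fun t => φ (H s₀ t) (H s t) * w s₀ t := by
      intro t
      obtain ⟨W, hWo, hW, a, b⟩ := hs t trivial
      filter_upwards [hw s₀ t, (hc s₀).continuousAt.eventually (hWo.mem_nhds a),
        (hc s).continuousAt.eventually (hWo.mem_nhds b)] with r hr ha hb
      rw [hr, ← mul_assoc, ← mul_assoc, hW _ a _ ha _ hb, hW _ a _ b _ hb]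
    rw [(hw s).unique hv 1 0, h0 s, h1 s, h0 s₀, h1 s₀, h.self, h.self, one_mul, one_mul]
  have := hloc.apply_eq_of_isPreconnected isPreconnected_univ (Set.mem_univ 0) (Set.mem_univ 1)
  rw [hu.unique (hw 0), this, (hw 1).unique hv]

/-- The representation defined by a local cocycle: its holonomies are given by parallel
transport. -/
theorem IsLocalCocycle.exists_rep {φ : X → X → SU2} (h : IsLocalCocycle φ) :
    ∃ ρ : SU2Rep X, ∀ {x y : X} (γ : Path x y) (u : I → SU2), IsTransport φ γ u →
      ρ.along γ = u 1 * (u 0)⁻¹ := by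
  choose u hu using fun (x y : X) (γ : Path x y) => h.exists_transport γ.continuous
  refine ⟨SU2Rep.ofPaths (fun {x y} γ => u x y γ 1 * (u x y γ 0)⁻¹) ?_ ?_ ?_, ?_⟩
  · rintro x y γ δ ⟨H⟩
    refine h.transport_homotopy (H := fun s t => H (s, t)) H.continuous (by simp) (by simp)
      (u := u x y γ) (v := u x y δ) ?_ ?_
    · simpa [Function.comp_def] using hu x y γ
    · simpa using hu x y δ
  · intro x
    have h1 : IsTransport φ (Path.refl x) fun _ => (1 : SU2) := by
      intro t
      simp [h.self]
    simpa using (hu x x (Path.refl x)).unique h1 1 0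
  · intro x y z γ δ
    set w := u x z (γ.trans δ)
    have hw := hu x z (γ.trans δ)
    let f : I → I := fun t => ⟨t / 2, by have := t.2; constructor <;> linarith [this.1, this.2]⟩
    let g : I → I := fun t =>
      ⟨(t + 1) / 2, by have := t.2; constructor <;> linarith [this.1, this.2]⟩
    have hf : Continuous f := by fun_prop
    have hg : Continuous g := by fun_prop
    -- The transport along the concatenation, restricted to either half, is a transport along the
    -- corresponding factor; uniqueness then gives multiplicativity.
    have ef : (γ.trans δ) ∘ f = γ := by
      funext t
      have : (t : ℝ) / 2 ≤ 1 / 2 := by linarith [t.2.2]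
      simp only [Function.comp_apply, Path.trans_apply, f, dif_pos this]
      congr 1
      ext
      simp only
      ring
    have eg : (γ.trans δ) ∘ g = δ := by
      funext t
      simp only [Function.comp_apply, Path.trans_apply, g]
      split_ifs with ht
      · have : t = 0 := by
          ext
          simp only [Set.Icc.coe_zero]
          linarith [t.2.1]
        subst this
        simp
      · congr 1
        ext
        simp only
        ring
    have h1 := hw.comp hf
    have h2 := hw.comp hg
    rw [ef] at h1
    rw [eg] at h2
    rw [(hu x y γ).unique h1, (hu y z δ).unique h2]
    have e0 : f 0 = 0 := by ext; simp [f]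
    have e1 : f 1 = g 0 := by ext; simp [f, g]
    have e2 : g 1 = 1 := by ext; simp [g]
    simp only [Function.comp_apply, e0, e1, e2]
    group
    rfl
  · intro x y γ v hv
    rw [SU2Rep.ofPaths_along]
    exact (hu x y γ).unique hv 1 0

end Transport

/-! ### Classification of the representations of the twice punctured plane. -/

section PuncturedPlane

open Topology unitInterval Filter

/-- The plane punctured at `2` and `-2`. -/
abbrev PuncturedPlane : Type := {z : ℂ // z ≠ 2 ∧ z ≠ -2}

/-- Names for the pieces of an open cover of the punctured plane by convex sets. -/
inductive Region
  | left | mid | right | upper | lower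

/-- The convex pieces: three vertical slabs and two half planes. -/
def Region.set : Region → Set ℂ
  | left => {z | z.re < -2}
  | mid => {z | -2 < z.re ∧ z.re < 2}
  | right => {z | 2 < z.re}
  | upper => {z | 0 < z.im}
  | lower => {z | z.im < 0}

theorem Region.convex_set (R : Region) : Convex ℝ R.set := by
  cases R
  · exact convex_halfSpace_re_lt _
  · exact (convex_halfSpace_re_gt (-2)).inter (convex_halfSpace_re_lt 2)
  · exact convex_halfSpace_re_gt _
  · exact convex_halfSpace_im_gt _
  · exact convex_halfSpace_im_lt _

theorem Region.isOpen_set (R : Region) : IsOpen R.set := by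
  cases R
  · exact isOpen_lt Complex.continuous_re continuous_const
  · exact (isOpen_lt continuous_const Complex.continuous_re).inter
      (isOpen_lt Complex.continuous_re continuous_const)
  · exact isOpen_lt continuous_const Complex.continuous_re
  · exact isOpen_lt continuous_const Complex.continuous_im
  · exact isOpen_lt Complex.continuous_im continuous_const

theorem Region.set_subset (R : Region) : R.set ⊆ {z | z ≠ 2 ∧ z ≠ -2} := by
  rintro z hz
  refine ⟨?_, ?_⟩ <;> rintro rfl <;> cases R <;> norm_num [Region.set] at hz

theorem Region.exists_mem (z : PuncturedPlane) : ∃ R : Region, (z : ℂ) ∈ R.set := by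
  obtain ⟨z, h2, h2'⟩ := z
  rcases lt_trichotomy z.im 0 with h | h | h
  · exact ⟨lower, h⟩
  · rcases lt_trichotomy z.re 2 with k | k | k
    · rcases lt_trichotomy z.re (-2) with l | l | l
      · exact ⟨left, l⟩
      · exact absurd (Complex.ext (by simpa using l) (by simpa using h)) h2'
      · exact ⟨mid, l, k⟩
    · exact absurd (Complex.ext (by simpa using k) (by simpa using h)) h2
    · exact ⟨right, k⟩
  · exact ⟨upper, h⟩

/-- Holonomies along paths inside a convex set have a potential. -/
theorem exists_potential (ρ : SU2Rep PuncturedPlane) {S : Set ℂ} (hS : Convex ℝ S)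
    (hsub : S ⊆ {z | z ≠ 2 ∧ z ≠ -2}) :
    ∃ a : PuncturedPlane → SU2, ∀ (x y : PuncturedPlane) (γ : Path x y), (∀ t, (γ t : ℂ) ∈ S) →
      ρ.along γ = a y * (a x)⁻¹ := by
  classical
  rcases S.eq_empty_or_nonempty with rfl | ⟨p, hp⟩
  · exact ⟨fun _ => 1, fun x y γ h => absurd (h 0) (Set.notMem_empty _)⟩
  have : ContractibleSpace S := hS.contractibleSpace ⟨p, hp⟩
  let j : C(S, PuncturedPlane) := ⟨fun z => ⟨z, hsub z.2⟩, by fun_prop⟩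
  -- The potential is the holonomy from a base point inside `S`, well defined since `S` is simply
  -- connected; outside `S` its value plays no role.
  refine ⟨fun y => if h : (y : ℂ) ∈ S then
    (ρ.pullback j).along (PathConnectedSpace.somePath ⟨p, hp⟩ ⟨y, h⟩) else 1, ?_⟩
  intro x y γ h
  have hx : (x : ℂ) ∈ S := by simpa using h 0
  have hy : (y : ℂ) ∈ S := by simpa using h 1
  let δ : Path (⟨x, hx⟩ : S) ⟨y, hy⟩ :=
    { toFun := fun t => ⟨γ t, h t⟩
      continuous_toFun := by fun_prop
      source' := by simp
      target' := by simp }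
  have e : ρ.along γ = (ρ.pullback j).along δ := by
    rw [SU2Rep.pullback_along]
    rfl
  beta_reduce
  rw [dif_pos hx, dif_pos hy, e, eq_mul_inv_iff_mul_eq, ← SU2Rep.along_trans]
  exact SU2Rep.along_congr _ (SimplyConnectedSpace.paths_homotopic _ _)

theorem potential_unique (ρ : SU2Rep PuncturedPlane) {S : Set ℂ} (hS : Convex ℝ S)
    (hsub : S ⊆ {z | z ≠ 2 ∧ z ≠ -2}) {a b : PuncturedPlane → SU2}
    (ha : ∀ (x y : PuncturedPlane) (γ : Path x y), (∀ t, (γ t : ℂ) ∈ S) → ρ.along γ = a y * (a x)⁻¹)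
    (hb : ∀ (x y : PuncturedPlane) (γ : Path x y), (∀ t, (γ t : ℂ) ∈ S) → ρ.along γ = b y * (b x)⁻¹) :
    ∃ m, ∀ x : PuncturedPlane, (x : ℂ) ∈ S → b x = a x * m := by
  rcases S.eq_empty_or_nonempty with rfl | ⟨p, hp⟩
  · exact ⟨1, fun x hx => absurd hx (Set.notMem_empty _)⟩
  refine ⟨(a ⟨p, hsub hp⟩)⁻¹ * b ⟨p, hsub hp⟩, fun x hx => ?_⟩
  have := hS.contractibleSpace ⟨p, hp⟩
  let j : C(S, PuncturedPlane) := ⟨fun z => ⟨z, hsub z.2⟩, by fun_prop⟩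
  let γ : Path (⟨p, hsub hp⟩ : PuncturedPlane) x :=
    (PathConnectedSpace.somePath (⟨p, hp⟩ : S) ⟨x, hx⟩).map j.continuous
  have h : ∀ t, (γ t : ℂ) ∈ S := fun t =>
    (PathConnectedSpace.somePath (⟨p, hp⟩ : S) ⟨x, hx⟩ t).2
  have e := (ha _ _ γ h).symm.trans (hb _ _ γ h)
  rw [← mul_assoc, e, inv_mul_cancel_right]

/-- The local trivialisations of the model representation with monodromies `A`, `C`. -/
noncomputable def Region.frame (A C : SU2) : Region → ℂ → SU2
  | left, z => if 0 ≤ z.im then 1 else C⁻¹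
  | mid, _ => 1
  | right, z => if 0 ≤ z.im then 1 else A
  | upper, _ => 1
  | lower, _ => 1

/-- The cocycle of the model representation with monodromies `A`, `C`: crossing the real axis
downwards contributes `C⁻¹`, `1` or `A`. -/
noncomputable def crossing (A C : SU2) (x y : PuncturedPlane) : SU2 :=
  if (0 ≤ (x : ℂ).im ↔ 0 ≤ (y : ℂ).im) then 1
  else
    let g : SU2 := if (x : ℂ).re < -2 then C⁻¹ else if (x : ℂ).re ≤ 2 then 1 else A
    if 0 ≤ (x : ℂ).im then g else g⁻¹

/-- Within a region, `crossing` is a coboundary, hence a cocycle. Points of the real axis count as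
upper points. On pairs lying in no common region, `crossing` need not be a cocycle. -/
theorem crossing_eq (A C : SU2) (R : Region) (x y : PuncturedPlane) (hx : (x : ℂ) ∈ R.set)
    (hy : (y : ℂ) ∈ R.set) : crossing A C x y = R.frame A C y * (R.frame A C x)⁻¹ := by
  cases R <;> simp only [Region.set, Set.mem_ofPred_eq] at hx hy
  · by_cases h1 : 0 ≤ (x : ℂ).im <;> by_cases h2 : 0 ≤ (y : ℂ).im <;>
      simp [crossing, Region.frame, h1, h2, hx]
  · by_cases h1 : 0 ≤ (x : ℂ).im <;> by_cases h2 : 0 ≤ (y : ℂ).im <;>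
      simp [crossing, Region.frame, h1, h2, hx.1.not_gt, hx.2.le]
  · have h3 : ¬ (x : ℂ).re < -2 := by linarith
    by_cases h1 : 0 ≤ (x : ℂ).im <;> by_cases h2 : 0 ≤ (y : ℂ).im <;>
      simp [crossing, Region.frame, h1, h2, h3, hx.not_ge]
  · simp [crossing, Region.frame, hx.le, hy.le]
  · simp [crossing, Region.frame, hx.not_ge, hy.not_ge]

theorem isLocalCocycle_crossing (A C : SU2) : IsLocalCocycle (crossing A C) := by
  intro x
  obtain ⟨R, hR⟩ := Region.exists_mem x
  refine ⟨Subtype.val ⁻¹' R.set, R.isOpen_set.preimage continuous_subtype_val, hR, ?_⟩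
  intro a ha b hb c hc
  rw [crossing_eq A C R _ _ hb hc, crossing_eq A C R _ _ ha hb, crossing_eq A C R _ _ ha hc]
  group

/-- The representation of the punctured plane with monodromies `A`, `C`. -/
noncomputable def modelRep (A C : SU2) : SU2Rep PuncturedPlane :=
  (isLocalCocycle_crossing A C).exists_rep.choose

theorem modelRep_along (A C : SU2) {x y : PuncturedPlane} (γ : Path x y) (u : I → SU2)
    (hu : ∀ t, ∃ (R : Region) (c : SU2), (γ t : ℂ) ∈ R.set ∧
      ∀ᶠ s in 𝓝 t, u s = R.frame A C (γ s) * c) :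
    (modelRep A C).along γ = u 1 * (u 0)⁻¹ := by
  refine (isLocalCocycle_crossing A C).exists_rep.choose_spec γ u fun t => ?_
  obtain ⟨R, c, hR, h⟩ := hu t
  have ht := h.self_of_nhds
  have hev : ∀ᶠ s in 𝓝 t, (γ s : ℂ) ∈ R.set :=
    (continuous_subtype_val.comp γ.continuous).continuousAt.eventually (R.isOpen_set.mem_nhds hR)
  filter_upwards [h, hev] with s h1 h2
  rw [h1, ht, crossing_eq A C R _ _ hR h2]
  group

theorem modelRep_along_region (A C : SU2) (R : Region) {x y : PuncturedPlane} (γ : Path x y)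
    (h : ∀ t, (γ t : ℂ) ∈ R.set) :
    (modelRep A C).along γ = R.frame A C y * (R.frame A C x)⁻¹ := by
  rw [modelRep_along A C γ (fun t => R.frame A C (γ t))
    fun t => ⟨R, 1, h t, Eventually.of_forall fun s => (mul_one _).symm⟩]
  simp

/-- Both representations are coboundaries in each region, so a gauge transformation that matches
their potentials region by region intertwines them on small paths, hence on all paths. -/
theorem intertwines_modelRep_of_regions (ρ : SU2Rep PuncturedPlane) (A C : SU2)
    (h : PuncturedPlane → SU2)
    (H : ∀ R : Region, ∃ b : PuncturedPlane → SU2,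
      (∀ (x y : PuncturedPlane) (γ : Path x y), (∀ t, (γ t : ℂ) ∈ R.set) → ρ.along γ = b y * (b x)⁻¹) ∧
      ∀ z : PuncturedPlane, (z : ℂ) ∈ R.set → h z = R.frame A C z * (b z)⁻¹) :
    SU2Rep.Intertwines ρ (modelRep A C) h := by
  refine SU2Rep.intertwines_of_cover
    (c := fun R : Region => ((↑) : PuncturedPlane → ℂ) ⁻¹' R.set)
    (fun R => R.isOpen_set.preimage continuous_subtype_val) Region.exists_mem _ _ _ ?_
  intro R x y γ hγ
  obtain ⟨b, hb, hh⟩ := H R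
  have hx : (x : ℂ) ∈ R.set := by simpa using hγ 0
  have hy : (y : ℂ) ∈ R.set := by simpa using hγ 1
  rw [modelRep_along_region A C R γ hγ, hb x y γ hγ, hh x hx, hh y hy]
  group

theorem modelRep_conj (A C P : SU2) :
    SU2Rep.Intertwines (modelRep A C) (modelRep (P * A * P⁻¹) (P * C * P⁻¹)) fun _ => P := by
  refine intertwines_modelRep_of_regions _ _ _ _ fun R =>
    ⟨fun z => R.frame A C z * P⁻¹, fun x y γ hγ => ?_, fun z _ => ?_⟩
  · rw [modelRep_along_region A C R γ hγ]
    group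
  · cases R <;> simp only [Region.frame] <;> try split_ifs
    all_goals group

/-- Every representation of the punctured plane is equivalent to a model representation. -/
theorem exists_intertwines_modelRep (ρ : SU2Rep PuncturedPlane) :
    ∃ A C h, SU2Rep.Intertwines ρ (modelRep A C) h := by
  choose a ha using fun R : Region => exists_potential ρ R.convex_set R.set_subset
  have cmp : ∀ R S : Region, ∃ m, ∀ x : PuncturedPlane, (x : ℂ) ∈ R.set → (x : ℂ) ∈ S.set →
      a S x = a R x * m := fun R S => by
    obtain ⟨m, hm⟩ := potential_unique ρ (R.convex_set.inter S.convex_set)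
      (Set.inter_subset_left.trans R.set_subset) (a := a R) (b := a S)
      (fun x y γ h => ha R x y γ fun t => (h t).1) (fun x y γ h => ha S x y γ fun t => (h t).2)
    exact ⟨m, fun x h1 h2 => hm x ⟨h1, h2⟩⟩
  choose m hm using cmp
  -- The upper potential, continued through the slab `R`, becomes `a .lower` times `n R` below the
  -- axis. The gauge `h` normalises by the passage through `mid`, so only `(n .mid)⁻¹ * n R`
  -- survives for the two outer slabs: this is `A` on the right and `C⁻¹` on the left.
  let n : Region → SU2 := fun R => m .lower R * (m .upper R)⁻¹
  let h : PuncturedPlane → SU2 := fun z =>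
    if 0 < (z : ℂ).im then (a .upper z)⁻¹
    else if (z : ℂ).im < 0 then (a .lower z * n .mid)⁻¹
    else if (z : ℂ).re < -2 then (a .left z * (m .upper .left)⁻¹)⁻¹
    else if (z : ℂ).re ≤ 2 then (a .mid z * (m .upper .mid)⁻¹)⁻¹
    else (a .right z * (m .upper .right)⁻¹)⁻¹
  refine ⟨(n .mid)⁻¹ * n .right, ((n .mid)⁻¹ * n .left)⁻¹, h,
    intertwines_modelRep_of_regions _ _ _ _ ?_⟩
  have shift : ∀ (R : Region) (q : SU2) (x y : PuncturedPlane) (γ : Path x y), (∀ t, (γ t : ℂ) ∈ R.set) →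
      ρ.along γ = (a R y * q) * (a R x * q)⁻¹ := fun R q x y γ hγ => by
    rw [ha R x y γ hγ]
    group
  -- The potential of each slab is shifted to agree with the upper one above the axis; below it, the
  -- frame records the jump.
  have slab : ∀ R : Region, ∀ z : PuncturedPlane, (z : ℂ) ∈ R.set →
      ((z : ℂ).im = 0 → h z = (a R z * (m .upper R)⁻¹)⁻¹) →
      h z = (if 0 ≤ (z : ℂ).im then 1 else (n .mid)⁻¹ * n R) * (a R z * (m .upper R)⁻¹)⁻¹ := by
    intro R z hz h0
    rcases lt_trichotomy (z : ℂ).im 0 with hlt | heq | hgt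
    · rw [if_neg hlt.not_ge, hm .lower R z hlt hz]
      simp only [h, if_neg hlt.not_gt, if_pos hlt, n]
      group
    · rw [if_pos heq.ge, h0 heq, one_mul]
    · rw [if_pos hgt.le, hm .upper R z hgt hz]
      simp only [h, if_pos hgt]
      group
  intro R
  cases R
  · refine ⟨_, shift .left (m .upper .left)⁻¹, fun z hz => ?_⟩
    rw [slab .left z hz fun h0 => ?_]
    · simp [Region.frame]
    · have : (z : ℂ).re < -2 := hz
      simp [h, h0, this]
  · refine ⟨_, shift .mid (m .upper .mid)⁻¹, fun z hz => ?_⟩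
    rw [slab .mid z hz fun h0 => ?_]
    · simp [Region.frame]
    · simp [h, h0, hz.1.not_gt, hz.2.le]
  · refine ⟨_, shift .right (m .upper .right)⁻¹, fun z hz => ?_⟩
    rw [slab .right z hz fun h0 => ?_]
    · simp [Region.frame]
    · have h1 : 2 < (z : ℂ).re := hz
      have h2 : ¬ (z : ℂ).re < -2 := by linarith
      simp [h, h0, h1.not_ge, h2]
  · refine ⟨_, shift .upper 1, fun z hz => ?_⟩
    have : 0 < (z : ℂ).im := hz
    simp [h, this, Region.frame]
  · refine ⟨_, shift .lower (n .mid), fun z hz => ?_⟩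
    have : (z : ℂ).im < 0 := hz
    simp [h, this, this.not_gt, Region.frame]

end PuncturedPlane

/-! ### The trinion as a retract of the punctured plane, and its boundary holonomies. -/

section TrinionRepresentations

open Topology unitInterval Filter

namespace Trinion

/-- The inclusion of the trinion in the punctured plane. -/
def incl : C(Trinion, PuncturedPlane) where
  toFun z := ⟨z.1, fun h => by simpa [h] using z.2.2.1.trans_lt' one_pos,
    fun h => by simpa [h] using z.2.2.2.trans_lt' one_pos⟩
  continuous_toFun := Continuous.subtype_mk continuous_subtype_val _

/-- Push the points of the disc of radius `1` around `c` radially to its boundary. -/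
noncomputable def pushOut (c z : ℂ) : ℂ := c + ((min 1 ‖z - c‖ : ℝ) : ℂ)⁻¹ * (z - c)

/-- Pull the points outside the disc of radius `4` radially to its boundary. -/
noncomputable def pullIn (z : ℂ) : ℂ := ((max 1 (‖z‖ / 4) : ℝ) : ℂ)⁻¹ * z

theorem pushOut_of_le {c z : ℂ} (h : 1 ≤ ‖z - c‖) : pushOut c z = z := by
  simp [pushOut, min_eq_left h]

theorem norm_pushOut_sub {c z : ℂ} (hz : z ≠ c) (h : ‖z - c‖ ≤ 1) : ‖pushOut c z - c‖ = 1 := by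
  have : ‖z - c‖ ≠ 0 := norm_ne_zero_iff.2 (sub_ne_zero.2 hz)
  simp [pushOut, min_eq_right h, this]

theorem pullIn_of_le {z : ℂ} (h : ‖z‖ ≤ 4) : pullIn z = z := by
  have : ‖z‖ / 4 ≤ 1 := by linarith
  simp [pullIn, max_eq_left this]

theorem norm_pullIn {z : ℂ} (h : 4 ≤ ‖z‖) : ‖pullIn z‖ = 4 := by
  have h1 : 1 ≤ ‖z‖ / 4 := by linarith
  have h2 : ‖z‖ ≠ 0 := by linarith
  rw [pullIn, max_eq_right h1, norm_mul, norm_inv, Complex.norm_real,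
    Real.norm_of_nonneg (by positivity)]
  field_simp

/-- The second push cannot spoil the first: a point at distance 1 from `-2` is at distance at least
3 from `2`. -/
theorem pushOut_mem (z : PuncturedPlane) : 1 ≤ ‖pushOut (-2) (pushOut 2 z) - 2‖ ∧
    1 ≤ ‖pushOut (-2) (pushOut 2 z) - (-2)‖ := by
  obtain ⟨z, h2, h2'⟩ := z
  have hn : ‖(4 : ℂ)‖ = 4 := by norm_num
  set w := pushOut 2 z with hw
  have h1 : 1 ≤ ‖w - 2‖ ∧ w ≠ -2 := by
    rcases le_total ‖z - 2‖ 1 with h | h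
    · have := norm_pushOut_sub h2 h
      refine ⟨this.ge, fun e => ?_⟩
      rw [← hw, e] at this
      norm_num at this
    · rw [hw, pushOut_of_le h]
      exact ⟨h, h2'⟩
  change 1 ≤ ‖pushOut (-2) w - 2‖ ∧ 1 ≤ ‖pushOut (-2) w - (-2)‖
  rcases le_total ‖w - (-2)‖ 1 with h | h
  · have e := norm_pushOut_sub h1.2 h
    refine ⟨?_, e.ge⟩
    have := norm_sub_norm_le 4 (pushOut (-2) w - (-2))
    rw [e, hn, show (4 : ℂ) - (pushOut (-2) w - (-2)) = -(pushOut (-2) w - 2) by ring,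
      norm_neg] at this
    linarith
  · rw [pushOut_of_le h]
    exact ⟨h1.1, h⟩

theorem pullIn_mem {z : ℂ} (h1 : 1 ≤ ‖z - 2‖) (h2 : 1 ≤ ‖z - (-2)‖) :
    ‖pullIn z‖ ≤ 4 ∧ 1 ≤ ‖pullIn z - 2‖ ∧ 1 ≤ ‖pullIn z + 2‖ := by
  rcases le_total ‖z‖ 4 with h | h
  · rw [pullIn_of_le h]
    exact ⟨h, h1, by simpa using h2⟩
  · have e := norm_pullIn h
    have n2 : ‖(2 : ℂ)‖ = 2 := by norm_num
    have a := norm_sub_norm_le (pullIn z) 2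
    have b := norm_sub_le_norm_add (pullIn z) 2
    exact ⟨e.le, by linarith, by linarith⟩

theorem continuousAt_pushOut {c z : ℂ} (hz : z ≠ c) : ContinuousAt (pushOut c) z := by
  have h : ((min 1 ‖z - c‖ : ℝ) : ℂ) ≠ 0 := by
    have : 0 < ‖z - c‖ := norm_pos_iff.2 (sub_ne_zero.2 hz)
    exact_mod_cast (lt_min one_pos this).ne'
  unfold pushOut
  have h' : ContinuousAt (fun z => ((min 1 ‖z - c‖ : ℝ) : ℂ)) z := by fun_prop
  exact continuousAt_const.add ((h'.inv₀ h).mul (by fun_prop))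

theorem continuous_pullIn : Continuous pullIn := by
  unfold pullIn
  refine Continuous.mul (Continuous.inv₀ (by fun_prop) fun z => ?_) continuous_id
  have : 0 < max 1 (‖z‖ / 4) := lt_max_of_lt_left one_pos
  exact_mod_cast this.ne'

/-- A retraction of the punctured plane to the trinion. -/
noncomputable def retract : C(PuncturedPlane, Trinion) where
  toFun z := ⟨pullIn (pushOut (-2) (pushOut 2 z)),
    pullIn_mem (pushOut_mem z).1 (pushOut_mem z).2⟩
  continuous_toFun := by
    refine Continuous.subtype_mk (continuous_pullIn.comp ?_) _
    rw [continuous_iff_continuousAt]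
    intro z
    have h1 : ContinuousAt (fun z : PuncturedPlane => pushOut 2 z) z :=
      (continuousAt_pushOut z.2.1).comp continuous_subtype_val.continuousAt
    refine ContinuousAt.comp (g := pushOut (-2)) (continuousAt_pushOut ?_) h1
    intro e
    have := (pushOut_mem z).2
    -- The centre is a fixed point of the formula, since the zero difference annihilates the factor
    -- `0⁻¹`.
    have h4 : pushOut (-2) (pushOut 2 (z : ℂ)) = -2 := by rw [e]; simp [pushOut]
    rw [h4] at this
    norm_num at this

theorem retract_incl (z : Trinion) : retract (incl z) = z := by
  obtain ⟨z, h, h1, h2⟩ := z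
  refine Subtype.ext ?_
  change pullIn (pushOut (-2) (pushOut 2 z)) = z
  rw [pushOut_of_le h1, pushOut_of_le (by simpa using h2), pullIn_of_le h]

/-- The representation of the trinion with monodromies `A`, `C`. -/
noncomputable def rep (A C : SU2) : SU2Rep Trinion := (modelRep A C).pullback incl

theorem rep_conj (A C P : SU2) :
    SU2Rep.Intertwines (rep A C) (rep (P * A * P⁻¹) (P * C * P⁻¹)) fun _ => P :=
  (modelRep_conj A C P).pullback incl

/-- Every representation of the trinion is equivalent to one of the model representations. -/
theorem exists_intertwines_rep (ρ : SU2Rep Trinion) :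
    ∃ A C h, SU2Rep.Intertwines ρ (rep A C) h := by
  obtain ⟨A, C, h, hh⟩ := exists_intertwines_modelRep (ρ.pullback retract)
  exact ⟨A, C, _, (SU2Rep.intertwines_pullback_of_leftInverse retract incl retract_incl ρ).trans
    (hh.pullback incl)⟩

theorem boundary_zero_coe (θ : ℝ) :
    ((incl (boundary 0 θ) : PuncturedPlane) : ℂ) = ⟨4 * Real.cos θ, 4 * Real.sin θ⟩ := by
  change circlePoint 0 θ = _
  apply Complex.ext <;> simp [circlePoint, Complex.exp_re, Complex.exp_im]

theorem boundary_one_coe (θ : ℝ) :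
    ((incl (boundary 1 θ) : PuncturedPlane) : ℂ) = ⟨2 + Real.cos θ, -Real.sin θ⟩ := by
  change circlePoint 1 θ = _
  apply Complex.ext <;> simp [circlePoint, Complex.exp_re, Complex.exp_im]

theorem boundary_two_coe (θ : ℝ) :
    ((incl (boundary 2 θ) : PuncturedPlane) : ℂ) = ⟨-2 + Real.cos θ, -Real.sin θ⟩ := by
  change circlePoint 2 θ = _
  apply Complex.ext <;> simp [circlePoint, Complex.exp_re, Complex.exp_im]

theorem sin_two_pi_mul_pos {t : ℝ} (h0 : 0 < t) (h1 : t < 1 / 2) :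
    0 < Real.sin (2 * Real.pi * t) := by
  have := Real.pi_pos
  exact Real.sin_pos_of_pos_of_lt_pi (by positivity) (by nlinarith)

theorem sin_two_pi_mul_neg {t : ℝ} (h0 : 1 / 2 < t) (h1 : t < 1) :
    Real.sin (2 * Real.pi * t) < 0 := by
  have := Real.pi_pos
  rw [← Real.sin_sub_two_pi]
  exact Real.sin_neg_of_neg_of_neg_pi_lt (by nlinarith) (by nlinarith)

theorem sin_two_pi_mul_half : Real.sin (2 * Real.pi * (1 / 2)) = 0 := by
  rw [show 2 * Real.pi * (1 / 2) = Real.pi by ring, Real.sin_pi]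

theorem cos_two_pi_mul_half : Real.cos (2 * Real.pi * (1 / 2)) = -1 := by
  rw [show 2 * Real.pi * (1 / 2) = Real.pi by ring, Real.cos_pi]

theorem rep_along_of_local {A C : SU2} {i : Fin 3} (u : I → SU2)
    (hu : ∀ t : I, ∃ (R : Region) (c : SU2),
      ((incl (boundary i (2 * Real.pi * t)) : PuncturedPlane) : ℂ) ∈ R.set ∧
      ∀ᶠ s : I in 𝓝 t,
        u s = R.frame A C (incl (boundary i (2 * Real.pi * s)) : PuncturedPlane) * c) :
    (rep A C).along (boundaryLoop i) = u 1 * (u 0)⁻¹ :=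
  modelRep_along A C _ u hu

theorem unitInterval_cases (t : I) : t = 0 ∨ (0 < (t : ℝ) ∧ (t : ℝ) < 1 / 2) ∨ (t : ℝ) = 1 / 2 ∨
    (1 / 2 < (t : ℝ) ∧ (t : ℝ) < 1) ∨ t = 1 := by
  rcases t.2.1.eq_or_lt with h | h
  · exact Or.inl (Subtype.ext h.symm)
  rcases t.2.2.eq_or_lt with h' | h'
  · exact Or.inr (Or.inr (Or.inr (Or.inr (Subtype.ext h'))))
  rcases lt_trichotomy (t : ℝ) (1 / 2) with k | k | k
  · exact Or.inr (Or.inl ⟨h, k⟩)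
  · exact Or.inr (Or.inr (Or.inl k))
  · exact Or.inr (Or.inr (Or.inr (Or.inl ⟨k, h'⟩)))

theorem eventually_coe_lt {t : I} {a : ℝ} (h : (t : ℝ) < a) : ∀ᶠ s : I in 𝓝 t, (s : ℝ) < a :=
  continuous_subtype_val.continuousAt.eventually (gt_mem_nhds h)

theorem eventually_lt_coe {t : I} {a : ℝ} (h : a < (t : ℝ)) : ∀ᶠ s : I in 𝓝 t, a < (s : ℝ) :=
  continuous_subtype_val.continuousAt.eventually (lt_mem_nhds h)

/-- The clockwise loop starts at `3`, crosses the right slab downwards (`A`) and returns upwards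
through the middle (trivially). Its starting point counts as upper, so the transport jumps
immediately after time 0. -/
theorem rep_along_one (A C : SU2) : (rep A C).along (boundaryLoop 1) = A := by
  rw [rep_along_of_local (fun t : I => if (t : ℝ) = 0 then 1 else A)]
  · simp
  intro t
  simp only [boundary_one_coe]
  rcases unitInterval_cases t with rfl | ⟨h0, h1⟩ | h | ⟨h0, h1⟩ | rfl
  · refine ⟨.right, 1, by norm_num [Region.set], ?_⟩
    filter_upwards [eventually_coe_lt (a := 1 / 2) (by norm_num : ((0 : I) : ℝ) < 1 / 2)]
      with s hs
    rcases s.2.1.eq_or_lt with h | h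
    · simp [← h, Region.frame]
    · have := sin_two_pi_mul_pos h hs
      simp [h.ne', Region.frame, this.not_ge]
  · have := sin_two_pi_mul_pos h0 h1
    refine ⟨.lower, A, by simpa [Region.set] using this, ?_⟩
    filter_upwards [eventually_lt_coe h0] with s hs
    simp [hs.ne', Region.frame]
  · refine ⟨.mid, A, by rw [h, cos_two_pi_mul_half]; norm_num [Region.set], ?_⟩
    filter_upwards [eventually_lt_coe (a := 0) (by rw [h]; norm_num)] with s hs
    simp [hs.ne', Region.frame]
  · have := sin_two_pi_mul_neg h0 h1
    refine ⟨.upper, A, by simpa [Region.set] using this, ?_⟩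
    filter_upwards [eventually_lt_coe (a := 0) (by linarith)] with s hs
    simp [hs.ne', Region.frame]
  · refine ⟨.right, A, by norm_num [Region.set], ?_⟩
    filter_upwards [eventually_lt_coe (a := 1 / 2) (by norm_num : (1 / 2 : ℝ) < ((1 : I) : ℝ))]
      with s hs
    have hs0 : (s : ℝ) ≠ 0 := by linarith
    rcases s.2.2.eq_or_lt with h | h
    · simp [h, Region.frame]
    · have := sin_two_pi_mul_neg hs h
      simp [hs0, Region.frame, this.le]

/-- The clockwise loop starts at `-1`, descends through the middle and crosses the left slab upwards
at time `1/2`, which contributes the inverse of `C⁻¹`. -/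
theorem rep_along_two (A C : SU2) : (rep A C).along (boundaryLoop 2) = C := by
  rw [rep_along_of_local (fun t : I => if (t : ℝ) < 1 / 2 then 1 else C)]
  · norm_num
  intro t
  simp only [boundary_two_coe]
  rcases unitInterval_cases t with rfl | ⟨h0, h1⟩ | h | ⟨h0, h1⟩ | rfl
  · refine ⟨.mid, 1, by norm_num [Region.set], ?_⟩
    filter_upwards [eventually_coe_lt (a := 1 / 2) (by norm_num : ((0 : I) : ℝ) < 1 / 2)]
      with s hs
    rw [if_pos hs]
    simp [Region.frame]
  · have := sin_two_pi_mul_pos h0 h1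
    refine ⟨.lower, 1, by simpa [Region.set] using this, ?_⟩
    filter_upwards [eventually_coe_lt h1] with s hs
    rw [if_pos hs]
    simp [Region.frame]
  · refine ⟨.left, C, by rw [h, cos_two_pi_mul_half]; norm_num [Region.set], ?_⟩
    filter_upwards [eventually_lt_coe (a := 0) (by rw [h]; norm_num),
      eventually_coe_lt (a := 1) (by rw [h]; norm_num)] with s hs hs'
    rcases lt_trichotomy (s : ℝ) (1 / 2) with k | k | k
    · have := sin_two_pi_mul_pos hs k
      rw [if_pos k]
      simp [Region.frame, this.not_ge]
    · rw [if_neg k.not_lt, k, sin_two_pi_mul_half]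
      simp [Region.frame]
    · have := sin_two_pi_mul_neg k hs'
      rw [if_neg k.not_gt]
      simp [Region.frame, this.le]
  · have := sin_two_pi_mul_neg h0 h1
    refine ⟨.upper, C, by simpa [Region.set] using this, ?_⟩
    filter_upwards [eventually_lt_coe h0] with s hs
    rw [if_neg hs.not_gt]
    simp [Region.frame]
  · refine ⟨.mid, C, by norm_num [Region.set], ?_⟩
    filter_upwards [eventually_lt_coe (a := 1 / 2) (by norm_num : (1 / 2 : ℝ) < ((1 : I) : ℝ))]
      with s hs
    rw [if_neg hs.not_gt]
    simp [Region.frame]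

/-- The counterclockwise loop starts at `4`, crosses the left slab downwards (`C⁻¹`) just after time
`1/2`, and meets the axis again on the right from below (`A⁻¹`) exactly at time 1. -/
theorem rep_along_zero (A C : SU2) : (rep A C).along (boundaryLoop 0) = (C * A)⁻¹ := by
  rw [rep_along_of_local (fun t : I => if (t : ℝ) ≤ 1 / 2 then 1 else
    if (t : ℝ) < 1 then C⁻¹ else A⁻¹ * C⁻¹)]
  · norm_num
  intro t
  simp only [boundary_zero_coe]
  rcases unitInterval_cases t with rfl | ⟨h0, h1⟩ | h | ⟨h0, h1⟩ | rfl
  · refine ⟨.right, 1, by norm_num [Region.set], ?_⟩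
    filter_upwards [eventually_coe_lt (a := 1 / 2) (by norm_num : ((0 : I) : ℝ) < 1 / 2)]
      with s hs
    rw [if_pos hs.le]
    rcases s.2.1.eq_or_lt with h | h
    · simp [← h, Region.frame]
    · have := sin_two_pi_mul_pos h hs
      simp [Region.frame, this.le]
  · have := sin_two_pi_mul_pos h0 h1
    refine ⟨.upper, 1, by simpa [Region.set] using this, ?_⟩
    filter_upwards [eventually_coe_lt h1] with s hs
    rw [if_pos hs.le]
    simp [Region.frame]
  · refine ⟨.left, 1, by rw [h, cos_two_pi_mul_half]; norm_num [Region.set], ?_⟩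
    filter_upwards [eventually_lt_coe (a := 0) (by rw [h]; norm_num),
      eventually_coe_lt (a := 1) (by rw [h]; norm_num)] with s hs hs'
    rcases lt_trichotomy (s : ℝ) (1 / 2) with k | k | k
    · have := sin_two_pi_mul_pos hs k
      rw [if_pos k.le]
      simp [Region.frame, this.le]
    · rw [if_pos k.le, k, sin_two_pi_mul_half]
      simp [Region.frame]
    · have := sin_two_pi_mul_neg k hs'
      rw [if_neg k.not_ge, if_pos hs']
      simp [Region.frame, this.not_ge]
  · have := sin_two_pi_mul_neg h0 h1
    refine ⟨.lower, C⁻¹, mul_neg_of_pos_of_neg four_pos this, ?_⟩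
    filter_upwards [eventually_lt_coe h0, eventually_coe_lt h1] with s hs hs'
    rw [if_neg hs.not_ge, if_pos hs']
    simp [Region.frame]
  · refine ⟨.right, A⁻¹ * C⁻¹, by norm_num [Region.set], ?_⟩
    filter_upwards [eventually_lt_coe (a := 1 / 2) (by norm_num : (1 / 2 : ℝ) < ((1 : I) : ℝ))]
      with s hs
    rw [if_neg hs.not_ge]
    rcases s.2.2.eq_or_lt with h | h
    · simp [h, Region.frame]
    · have := sin_two_pi_mul_neg hs h
      simp [h, Region.frame, this.not_ge]

end Trinion

end TrinionRepresentations

/-! ### Pairs in SU(2) and the spherical triangle inequalities. -/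

section SU2Algebra

open ComplexConjugate

namespace SU2

/-- The element of `SU(2)` with first row `(p, q)`. -/
noncomputable def ofRow (p q : ℂ) (h : Complex.normSq p + Complex.normSq q = 1) : SU2 :=
  ⟨!![p, q; -conj q, conj p], by
    have h' : p * conj p + q * conj q = 1 := by
      rw [Complex.mul_conj, Complex.mul_conj]
      exact_mod_cast h
    rw [Matrix.mem_specialUnitaryGroup_iff, Matrix.mem_unitaryGroup_iff]
    constructor
    · ext i j
      fin_cases i <;> fin_cases j <;>
        simp [Matrix.mul_apply, Fin.sum_univ_two, Matrix.star_apply] <;>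
        first | ring1 | linear_combination h'
    · rw [Matrix.det_fin_two_of]
      linear_combination h'⟩

theorem ofRow_coe (p q : ℂ) (h) : (ofRow p q h : Matrix (Fin 2) (Fin 2) ℂ) =
    !![p, q; -conj q, conj p] := rfl

/-- For a unitary matrix of determinant 1 the adjoint is the inverse, hence the adjugate; comparing
entries determines the second row. -/
theorem exists_eq_ofRow (g : SU2) : ∃ p q h, g = ofRow p q h := by
  obtain ⟨M, hM⟩ := g
  have hM' := hM
  rw [Matrix.mem_specialUnitaryGroup_iff, Matrix.mem_unitaryGroup_iff'] at hM'
  obtain ⟨h1, h2⟩ := hM'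
  have hadj : star M = M.adjugate := by
    calc star M = star M * (M * M.adjugate) := by rw [Matrix.mul_adjugate, h2, one_smul, mul_one]
      _ = M.adjugate := by rw [← mul_assoc, h1, one_mul]
  rw [Matrix.adjugate_fin_two] at hadj
  have e00 := congrFun (congrFun hadj 0) 0
  have e10 := congrFun (congrFun hadj 1) 0
  have e01 := congrFun (congrFun hadj 0) 1
  simp only [Matrix.star_apply, Matrix.of_apply, Matrix.cons_val', Matrix.cons_val_zero,
    Matrix.cons_val_one, Matrix.cons_val_fin_one] at e00 e10 e01
  have e11 : conj (M 0 0) = M 1 1 := e00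
  have e12 : -conj (M 0 1) = M 1 0 := by
    rw [show conj (M 0 1) = - M 1 0 from e10, neg_neg]
  refine ⟨M 0 0, M 0 1, ?_, ?_⟩
  · rw [Matrix.det_fin_two, ← e11, ← e12] at h2
    have : ((Complex.normSq (M 0 0) + Complex.normSq (M 0 1) : ℝ) : ℂ) = 1 := by
      rw [Complex.ofReal_add, ← Complex.mul_conj, ← Complex.mul_conj]
      linear_combination h2
    exact_mod_cast this
  · apply Subtype.ext
    change M = _
    rw [ofRow_coe, e11, e12]
    exact Matrix.eta_fin_two M

theorem ofRow_mul (p q r s : ℂ) (h k) : ∃ l, ofRow p q h * ofRow r s k =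
    ofRow (p * r - q * conj s) (p * s + q * conj r) l := by
  obtain ⟨a, b, l, e⟩ := exists_eq_ofRow (ofRow p q h * ofRow r s k)
  have e' := congrArg Subtype.val e
  change (ofRow p q h : Matrix (Fin 2) (Fin 2) ℂ) * ofRow r s k = ofRow a b l at e'
  rw [ofRow_coe, ofRow_coe, ofRow_coe] at e'
  have e0 := congrFun (congrFun e' 0) 0
  have e1 := congrFun (congrFun e' 0) 1
  simp [Matrix.mul_apply, Fin.sum_univ_two] at e0 e1
  have e0' : p * r - q * conj s = a := by rw [← e0]; ring
  subst e0' e1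
  exact ⟨l, e⟩

theorem ofRow_inj {p q r s : ℂ} {h k} (e1 : p = r) (e2 : q = s) : ofRow p q h = ofRow r s k := by
  subst e1 e2
  rfl

/-- The angle in `[0, π]` of an element of `SU(2)`: its eigenvalues are `exp (± i angle)`. -/
noncomputable def angle (g : SU2) : ℝ :=
  Real.arccos (1 / 2 * (Matrix.trace (g : Matrix (Fin 2) (Fin 2) ℂ)).re)

theorem angle_ofRow (p q : ℂ) (h) : angle (ofRow p q h) = Real.arccos p.re := by
  rw [angle, ofRow_coe, Matrix.trace_fin_two_of]
  congr 1
  simp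
  ring

theorem abs_re_le_one {p q : ℂ} (h : Complex.normSq p + Complex.normSq q = 1) : |p.re| ≤ 1 := by
  rw [Complex.normSq_apply, Complex.normSq_apply] at h
  rw [← sq_le_one_iff_abs_le_one]
  linarith [mul_self_nonneg p.im, mul_self_nonneg q.re, mul_self_nonneg q.im, sq p.re]

theorem cos_angle_ofRow (p q : ℂ) (h) : Real.cos (angle (ofRow p q h)) = p.re := by
  rw [angle_ofRow]
  have := abs_le.1 (abs_re_le_one h)
  exact Real.cos_arccos this.1 this.2

theorem angle_conj (P g : SU2) : angle (P * g * P⁻¹) = angle g := by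
  rw [angle, angle, Submonoid.coe_mul, Matrix.trace_mul_comm, ← Submonoid.coe_mul,
    inv_mul_cancel_left]

theorem angle_inv (g : SU2) : angle g⁻¹ = angle g := by
  have : ((g⁻¹ : SU2) : Matrix (Fin 2) (Fin 2) ℂ) = star (g : Matrix (Fin 2) (Fin 2) ℂ) := rfl
  rw [angle, angle, this, Matrix.star_eq_conjTranspose, Matrix.trace_conjTranspose]
  simp

theorem angle_mem (g : SU2) : 0 ≤ angle g ∧ angle g ≤ Real.pi :=
  ⟨Real.arccos_nonneg _, Real.arccos_le_pi _⟩

/-- The diagonal matrix with entries `exp (± i θ)`. -/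
noncomputable def diag (θ : ℝ) : SU2 :=
  ofRow (Complex.exp (θ * Complex.I)) 0 (by
    rw [Complex.normSq_eq_norm_sq, Complex.norm_exp_ofReal_mul_I]
    simp)

theorem angle_diag {θ : ℝ} (h0 : 0 ≤ θ) (h1 : θ ≤ Real.pi) : angle (diag θ) = θ := by
  rw [diag, angle_ofRow, Complex.exp_ofReal_mul_I_re, Real.arccos_cos h0 h1]

theorem exists_conj_diag (g : SU2) : ∃ P : SU2, g = P * diag (angle g) * P⁻¹ := by
  obtain ⟨p, q, h, rfl⟩ := exists_eq_ofRow g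
  set θ := angle (ofRow p q h) with hθ
  set l := Complex.exp (θ * Complex.I) with hl
  have hll : l * conj l = 1 := by
    rw [Complex.mul_conj, Complex.normSq_eq_norm_sq, hl, Complex.norm_exp_ofReal_mul_I]
    simp
  have hsum : l + conj l = p + conj p := by
    rw [Complex.add_conj, Complex.add_conj, hl, Complex.exp_ofReal_mul_I_re, hθ, cos_angle_ofRow]
  have hpq : p * conj p + q * conj q = 1 := by
    rw [Complex.mul_conj, Complex.mul_conj]
    exact_mod_cast h
  -- The characteristic polynomial has real trace `2 cos θ` and determinant 1, so `l` is an
  -- eigenvalue.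
  have hdet : (!![p - l, q; -conj q, conj p - l] : Matrix (Fin 2) (Fin 2) ℂ).det = 0 := by
    rw [Matrix.det_fin_two_of]
    linear_combination hpq - hll + l * hsum
  obtain ⟨v, hv0, hv⟩ := Matrix.exists_mulVec_eq_zero_iff.2 hdet
  have v0 := congrFun hv 0
  have v1 := congrFun hv 1
  simp [Matrix.mulVec, dotProduct, Fin.sum_univ_two] at v0 v1
  have hpos : 0 < Complex.normSq (v 0) + Complex.normSq (v 1) := by
    by_contra hcon
    have n0 := Complex.normSq_nonneg (v 0)
    have n1 := Complex.normSq_nonneg (v 1)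
    apply hv0
    ext i
    fin_cases i
    · exact Complex.normSq_eq_zero.1 (show Complex.normSq (v 0) = 0 by linarith)
    · exact Complex.normSq_eq_zero.1 (show Complex.normSq (v 1) = 0 by linarith)
  set N : ℝ := Real.sqrt (Complex.normSq (v 0) + Complex.normSq (v 1)) with hN
  have hN2 : N * N = Complex.normSq (v 0) + Complex.normSq (v 1) :=
    Real.mul_self_sqrt hpos.le
  have hN0 : N ≠ 0 := (Real.sqrt_pos.2 hpos).ne'
  set a : ℂ := v 0 / N
  set b : ℂ := v 1 / N
  have hNc : (N : ℂ) ≠ 0 := by exact_mod_cast hN0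
  have ha : p * a + q * b = l * a := by
    simp only [a, b]
    field_simp
    linear_combination v0
  have hb : -conj q * a + conj p * b = l * b := by
    simp only [a, b]
    field_simp
    linear_combination v1
  have hb' : -q * conj a + p * conj b = conj l * conj b := by
    have := congrArg conj hb
    simpa using this
  have hab : Complex.normSq a + Complex.normSq (-conj b) = 1 := by
    rw [Complex.normSq_neg, Complex.normSq_conj]
    simp only [a, b, Complex.normSq_div, Complex.normSq_ofReal]
    rw [← add_div, ← hN2, div_self (mul_ne_zero hN0 hN0)]
  -- The first column is the unit eigenvector `(a, b)` for `l`; the second is its orthogonal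
  -- companion, an eigenvector for `conj l`.
  refine ⟨ofRow a (-conj b) hab, ?_⟩
  rw [eq_mul_inv_iff_mul_eq]
  obtain ⟨k1, e1⟩ := ofRow_mul p q a (-conj b) h hab
  obtain ⟨k2, e2⟩ := ofRow_mul a (-conj b) l 0 hab (by
    rw [hl, Complex.normSq_eq_norm_sq, Complex.norm_exp_ofReal_mul_I]
    simp)
  rw [e1, diag, e2]
  apply ofRow_inj
  · simp
    linear_combination ha
  · simp
    linear_combination -hb'

theorem exists_conj_of_angle_eq {g g' : SU2} (h : angle g = angle g') :
    ∃ P : SU2, P * g * P⁻¹ = g' := by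
  obtain ⟨P, hP⟩ := exists_conj_diag g
  obtain ⟨P', hP'⟩ := exists_conj_diag g'
  refine ⟨P' * P⁻¹, ?_⟩
  rw [hP', ← h]
  nth_rewrite 1 [hP]
  group

theorem exists_diag_conj {p q p' q' : ℂ} {h h'} (hp : p = p') :
    ∃ ψ : ℝ, diag ψ * ofRow p q h = ofRow p' q' h' * diag ψ := by
  subst hp
  have hn : ‖q‖ = ‖q'‖ := by
    have : Complex.normSq q = Complex.normSq q' := by linarith
    rw [Complex.normSq_eq_norm_sq, Complex.normSq_eq_norm_sq] at this
    exact (pow_left_inj₀ (norm_nonneg _) (norm_nonneg _) two_ne_zero).1 this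
  obtain ⟨ψ, hψ⟩ : ∃ ψ : ℝ, Complex.exp (ψ * Complex.I) * q =
      q' * conj (Complex.exp (ψ * Complex.I)) := by
    -- Conjugation by `diag ψ` rotates the off-diagonal entry by `2 ψ`, whence the half.
    refine ⟨(Complex.arg q' - Complex.arg q) / 2, ?_⟩
    have e : q = ‖q‖ * Complex.exp (q.arg * Complex.I) := (Complex.norm_mul_exp_arg_mul_I q).symm
    have e' : q' = ‖q'‖ * Complex.exp (q'.arg * Complex.I) :=
      (Complex.norm_mul_exp_arg_mul_I q').symm
    generalize q.arg = x at *
    generalize q'.arg = x' at *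
    rw [← Complex.exp_conj, e, e', hn, mul_left_comm, mul_assoc, ← Complex.exp_add, ← Complex.exp_add]
    congr 2
    simp only [Complex.ofReal_div, Complex.ofReal_sub, Complex.ofReal_ofNat, map_mul, map_div₀,
      map_sub, Complex.conj_ofReal, map_ofNat, Complex.conj_I]
    ring
  refine ⟨ψ, ?_⟩
  have hu : Complex.normSq (Complex.exp (ψ * Complex.I)) + Complex.normSq 0 = 1 := by
    rw [Complex.normSq_eq_norm_sq, Complex.norm_exp_ofReal_mul_I]
    simp
  obtain ⟨k1, e1⟩ := ofRow_mul (Complex.exp (ψ * Complex.I)) 0 p q hu h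
  obtain ⟨k2, e2⟩ := ofRow_mul p q' (Complex.exp (ψ * Complex.I)) 0 h' hu
  rw [diag, e1, e2]
  apply ofRow_inj
  · simp
    ring
  · simpa using hψ

theorem diag_commute (θ ψ : ℝ) : diag ψ * diag θ = diag θ * diag ψ := by
  have hu : ∀ θ : ℝ, Complex.normSq (Complex.exp (θ * Complex.I)) + Complex.normSq 0 = 1 := by
    intro θ
    rw [Complex.normSq_eq_norm_sq, Complex.norm_exp_ofReal_mul_I]
    simp
  obtain ⟨k1, e1⟩ := ofRow_mul (Complex.exp (ψ * Complex.I)) 0 _ 0 (hu ψ) (hu θ)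
  obtain ⟨k2, e2⟩ := ofRow_mul (Complex.exp (θ * Complex.I)) 0 _ 0 (hu θ) (hu ψ)
  rw [diag, diag, e1, e2]
  apply ofRow_inj
  · ring
  · simp

theorem diag_central {θ : ℝ} (h : Real.sin θ = 0) (g : SU2) : g * diag θ = diag θ * g := by
  obtain ⟨p, q, hpq, rfl⟩ := exists_eq_ofRow g
  have hu : Complex.normSq (Complex.exp (θ * Complex.I)) + Complex.normSq 0 = 1 := by
    rw [Complex.normSq_eq_norm_sq, Complex.norm_exp_ofReal_mul_I]
    simp
  have hreal : conj (Complex.exp (θ * Complex.I)) = Complex.exp (θ * Complex.I) := by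
    apply Complex.ext
    · simp
    · rw [Complex.conj_im, Complex.exp_ofReal_mul_I_im, h, neg_zero]
  obtain ⟨k1, e1⟩ := ofRow_mul p q _ 0 hpq hu
  obtain ⟨k2, e2⟩ := ofRow_mul (Complex.exp (θ * Complex.I)) 0 p q hu hpq
  rw [diag, e1, e2]
  apply ofRow_inj
  · simp
    ring
  · rw [hreal]
    ring

theorem angle_ofRow_mul_diag (p q : ℂ) (h) (θ : ℝ) :
    angle (ofRow p q h * diag θ) = Real.arccos (p.re * Real.cos θ - p.im * Real.sin θ) ∧
    Real.cos (angle (ofRow p q h * diag θ)) = p.re * Real.cos θ - p.im * Real.sin θ := by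
  obtain ⟨k1, e1⟩ := ofRow_mul p q (Complex.exp (θ * Complex.I)) 0 h (by
    rw [Complex.normSq_eq_norm_sq, Complex.norm_exp_ofReal_mul_I]
    simp)
  rw [diag, e1, cos_angle_ofRow, angle_ofRow]
  simp [Complex.exp_ofReal_mul_I_re, Complex.exp_ofReal_mul_I_im]

/-- A pair of elements of `SU(2)` is determined up to simultaneous conjugation by the angles of the
two elements and of their product. -/
theorem exists_simultaneous_conj {A C A' C' : SU2} (hA : angle A = angle A')
    (hC : angle C = angle C') (hCA : angle (C * A) = angle (C' * A')) :
    ∃ P : SU2, P * A * P⁻¹ = A' ∧ P * C * P⁻¹ = C' := by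
  obtain ⟨P, hP⟩ := exists_conj_diag A
  obtain ⟨P', hP'⟩ := exists_conj_diag A'
  rw [← hA] at hP'
  set θ := angle A
  obtain ⟨D, hD⟩ : ∃ D, D = P⁻¹ * C * P := ⟨_, rfl⟩
  obtain ⟨D', hD'⟩ : ∃ D', D' = P'⁻¹ * C' * P' := ⟨_, rfl⟩
  have hCD : C = P * D * P⁻¹ := by rw [hD]; group
  have hCD' : C' = P' * D' * P'⁻¹ := by rw [hD']; group
  have aD : angle D = angle D' := by rwa [hCD, hCD', angle_conj, angle_conj] at hC
  have aDD : angle (D * diag θ) = angle (D' * diag θ) := by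
    rw [hCD, hCD', hP, hP',
      show P * D * P⁻¹ * (P * diag θ * P⁻¹) = P * (D * diag θ) * P⁻¹ by group,
      show P' * D' * P'⁻¹ * (P' * diag θ * P'⁻¹) = P' * (D' * diag θ) * P'⁻¹ by group,
      angle_conj, angle_conj] at hCA
    exact hCA
  obtain ⟨Q, hQ1, hQ2⟩ : ∃ Q, Q * diag θ = diag θ * Q ∧ Q * D = D' * Q := by
    -- A central `diag θ` leaves only `D` to be conjugated. Otherwise the angle of the product
    -- determines `Im p`, and a diagonal `Q`, which commutes with `diag θ`, adjusts the phase of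
    -- `q`.
    by_cases hs : Real.sin θ = 0
    · obtain ⟨Q, hQ⟩ := exists_conj_of_angle_eq aD
      exact ⟨Q, diag_central hs Q, by rw [← hQ]; group⟩
    · obtain ⟨p, q, h, rfl⟩ := exists_eq_ofRow D
      obtain ⟨p', q', h', rfl⟩ := exists_eq_ofRow D'
      have hre : p.re = p'.re := by
        rw [← cos_angle_ofRow p q h, aD, cos_angle_ofRow]
      have him : p.im = p'.im := by
        have := (angle_ofRow_mul_diag p q h θ).2
        rw [aDD, (angle_ofRow_mul_diag p' q' h' θ).2, hre] at this
        have h2 : p'.im * Real.sin θ = p.im * Real.sin θ := by linarith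
        exact (mul_right_cancel₀ hs h2).symm
      obtain ⟨ψ, hψ⟩ := exists_diag_conj (q := q) (q' := q') (h := h) (h' := h')
        (Complex.ext hre him)
      exact ⟨diag ψ, diag_commute θ ψ, hψ⟩
  refine ⟨P' * Q * P⁻¹, ?_, ?_⟩
  · rw [hP', mul_inv_eq_iff_eq_mul]
    nth_rewrite 1 [hP]
    calc P' * Q * P⁻¹ * (P * diag θ * P⁻¹) = P' * (Q * diag θ) * P⁻¹ := by group
      _ = _ := by rw [hQ1]; group
  · rw [hCD', mul_inv_eq_iff_eq_mul, hCD]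
    calc P' * Q * P⁻¹ * (P * D * P⁻¹) = P' * (Q * D) * P⁻¹ := by group
      _ = _ := by rw [hQ2]; group

/-- Cosine is strictly decreasing on `[0, π]`. The bound by `2 π - a - b` arises when `a + b`
exceeds `π` and has to be reflected into that interval. -/
theorem cos_le_iff_triangle {a b c : ℝ} (ha : 0 ≤ a ∧ a ≤ Real.pi) (hb : 0 ≤ b ∧ b ≤ Real.pi)
    (hc : 0 ≤ c ∧ c ≤ Real.pi) :
    (Real.cos (a + b) ≤ Real.cos c ∧ Real.cos c ≤ Real.cos (a - b)) ↔
      (|a - b| ≤ c ∧ c ≤ a + b ∧ c ≤ 2 * Real.pi - a - b) := by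
  have habs : |a - b| ∈ Set.Icc 0 Real.pi := by
    refine ⟨abs_nonneg _, abs_le.2 ⟨?_, ?_⟩⟩ <;> linarith [ha.1, ha.2, hb.1, hb.2]
  have h1 : Real.cos c ≤ Real.cos (a - b) ↔ |a - b| ≤ c := by
    rw [← Real.cos_abs (a - b)]
    exact Real.strictAntiOn_cos.le_iff_ge hc habs
  have h2 : Real.cos (a + b) ≤ Real.cos c ↔ c ≤ a + b ∧ c ≤ 2 * Real.pi - a - b := by
    rcases le_total (a + b) Real.pi with h | h
    · rw [Real.strictAntiOn_cos.le_iff_ge ⟨by linarith [ha.1, hb.1], h⟩ hc]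
      exact ⟨fun k => ⟨k, by linarith⟩, fun k => k.1⟩
    · rw [← Real.cos_two_pi_sub (a + b), Real.strictAntiOn_cos.le_iff_ge
        ⟨by linarith [ha.2, hb.2], by linarith⟩ hc]
      exact ⟨fun k => ⟨by linarith, by linarith⟩, fun k => by linarith [k.2]⟩
  rw [h1, h2]
  tauto

/-- With `A` diagonal, `cos (angle (C * A))` differs from `cos τ cos θ` by `Im p sin θ`, and `|Im p|
≤ sin τ` because the row `(p, q)` is a unit vector with `Re p = cos τ`. -/
theorem angle_mul_triangle (A C : SU2) :
    |angle A - angle C| ≤ angle (C * A) ∧ angle (C * A) ≤ angle A + angle C ∧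
      angle (C * A) ≤ 2 * Real.pi - angle A - angle C := by
  rw [← cos_le_iff_triangle (angle_mem A) (angle_mem C) (angle_mem _)]
  obtain ⟨P, hP⟩ := exists_conj_diag A
  set θ := angle A
  obtain ⟨D, hD⟩ : ∃ D, D = P⁻¹ * C * P := ⟨_, rfl⟩
  have hCD : C = P * D * P⁻¹ := by rw [hD]; group
  have e : angle (C * A) = angle (D * diag θ) := by
    rw [hP, hCD, show P * D * P⁻¹ * (P * diag θ * P⁻¹) = P * (D * diag θ) * P⁻¹ by group,
      angle_conj]
  rw [e, hCD, angle_conj]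
  obtain ⟨p, q, h, rfl⟩ := exists_eq_ofRow D
  rw [(angle_ofRow_mul_diag p q h θ).2]
  set τ := angle (ofRow p q h) with hτ
  have hre : p.re = Real.cos τ := (cos_angle_ofRow p q h).symm
  have hs : 0 ≤ Real.sin τ := Real.sin_nonneg_of_nonneg_of_le_pi (angle_mem _).1 (angle_mem _).2
  have hs' : 0 ≤ Real.sin θ := Real.sin_nonneg_of_nonneg_of_le_pi (angle_mem _).1 (angle_mem _).2
  have him : |p.im| ≤ Real.sin τ := by
    apply abs_le_of_sq_le_sq _ hs
    have := Real.sin_sq_add_cos_sq τ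
    rw [Complex.normSq_apply, Complex.normSq_apply, hre] at h
    linarith [mul_self_nonneg q.re, mul_self_nonneg q.im, sq (Real.cos τ), sq p.im]
  have := abs_le.1 him
  rw [hre, Real.cos_add, Real.cos_sub]
  constructor <;> nlinarith

theorem exists_angles {a b c : ℝ} (ha : 0 ≤ a ∧ a ≤ Real.pi) (hb : 0 ≤ b ∧ b ≤ Real.pi)
    (hc : 0 ≤ c ∧ c ≤ Real.pi) (h1 : |a - b| ≤ c) (h2 : c ≤ a + b)
    (h3 : c ≤ 2 * Real.pi - a - b) :
    ∃ A C : SU2, angle A = a ∧ angle C = b ∧ angle (C * A) = c := by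
  have hcos := (cos_le_iff_triangle ha hb hc).2 ⟨h1, h2, h3⟩
  rw [Real.cos_add, Real.cos_sub] at hcos
  have hsa : 0 ≤ Real.sin a := Real.sin_nonneg_of_nonneg_of_le_pi ha.1 ha.2
  have hsb : 0 ≤ Real.sin b := Real.sin_nonneg_of_nonneg_of_le_pi hb.1 hb.2
  -- `y` will be the imaginary part of the first entry of `C`. If `sin a = 0`, the two bounds on
  -- `cos c` coincide and `y = 0` serves.
  obtain ⟨y, hy, hy'⟩ : ∃ y : ℝ, |y| ≤ Real.sin b ∧
      Real.cos b * Real.cos a - y * Real.sin a = Real.cos c := by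
    rcases hsa.eq_or_lt with h0 | h0
    · refine ⟨0, by simpa using hsb, ?_⟩
      rw [← h0] at hcos ⊢
      linarith
    · refine ⟨(Real.cos b * Real.cos a - Real.cos c) / Real.sin a, ?_, ?_⟩
      · rw [abs_div, abs_of_pos h0, div_le_iff₀ h0, abs_le]
        constructor <;> linarith
      · field_simp
        ring
  have hy2 : y ^ 2 ≤ Real.sin b ^ 2 := sq_le_sq.2 (by rwa [abs_of_nonneg hsb])
  have hrow : Complex.normSq (⟨Real.cos b, y⟩ : ℂ) +
      Complex.normSq ((Real.sqrt (Real.sin b ^ 2 - y ^ 2) : ℝ) : ℂ) = 1 := by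
    rw [Complex.normSq_ofReal, Real.mul_self_sqrt (by linarith), Complex.normSq_mk]
    linarith [Real.sin_sq_add_cos_sq b]
  refine ⟨diag a, ofRow _ _ hrow, angle_diag ha.1 ha.2, ?_, ?_⟩
  · rw [angle_ofRow]
    exact Real.arccos_cos hb.1 hb.2
  · rw [(angle_ofRow_mul_diag _ _ hrow a).1]
    simp only
    rw [hy', Real.arccos_cos hc.1 hc.2]

end SU2

instance : CompactSpace SU2 := by
  have hsub : {M : Matrix (Fin 2) (Fin 2) ℂ | M ∈ Matrix.specialUnitaryGroup (Fin 2) ℂ} ⊆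
      Set.pi Set.univ fun _ => Set.pi Set.univ fun _ => Metric.closedBall (0 : ℂ) 1 := by
    intro M hM i _ j _
    simpa using entry_norm_bound_of_unitary (Matrix.specialUnitaryGroup_le_unitaryGroup hM) i j
  have hcl : IsClosed {M : Matrix (Fin 2) (Fin 2) ℂ |
      M ∈ Matrix.specialUnitaryGroup (Fin 2) ℂ} := by
    simp only [Matrix.mem_specialUnitaryGroup_iff, Matrix.mem_unitaryGroup_iff]
    exact (isClosed_eq (by fun_prop) continuous_const).inter
      (isClosed_eq (Continuous.matrix_det continuous_id) continuous_const)
  exact isCompact_iff_compactSpace.1 ((isCompact_univ_pi fun _ =>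
    isCompact_univ_pi fun _ => isCompact_closedBall 0 1).of_isClosed_subset hcl hsub)

end SU2Algebra

/-! ### Goldman functions: invariance, continuity, and compactness of representation spaces. -/

section Goldman

open Topology

universe u v

variable {X : Type u} [TopologicalSpace X]

namespace SU2Rep

theorem goldman_eq_angle {x : X} (C : Path x x) (ρ : SU2Rep X) :
    ρ.goldman C = 1 / Real.pi * SU2.angle (ρ.along C) := rfl

theorem Intertwines.goldman_eq {ρ σ : SU2Rep X} {h : X → SU2} (hh : Intertwines ρ σ h) {x : X}
    (C : Path x x) : ρ.goldman C = σ.goldman C :=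
  goldman_congr C ρ σ ((setoid_iff ρ σ).2 ⟨h, hh⟩)

theorem goldman_symm {x : X} (C : Path x x) (ρ : SU2Rep X) :
    ρ.goldman C.symm = ρ.goldman C := by
  rw [goldman_eq_angle, goldman_eq_angle, along_symm, SU2.angle_inv]

theorem goldman_cast {x y : X} (C : Path x x) (h : y = x) (ρ : SU2Rep X) :
    ρ.goldman (C.cast h h) = ρ.goldman C := by
  subst h
  rfl

theorem continuous_goldman {x : X} (C : Path x x) :
    Continuous fun ρ : SU2Rep X => ρ.goldman C := by
  have h : Continuous fun (ρ : SU2Rep X) (γ : Σ x y : FundamentalGroupoid X, (x ⟶ y)) =>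
      ρ.hol γ.2.2 := continuous_induced_dom
  have h1 : Continuous fun ρ : SU2Rep X => ρ.hol (pathClass C) :=
    (continuous_apply (⟨_, _, pathClass C⟩ : Σ x y : FundamentalGroupoid X, (x ⟶ y))).comp h
  have h2 : Continuous fun ρ : SU2Rep X =>
      Matrix.trace (ρ.hol (pathClass C) : Matrix (Fin 2) (Fin 2) ℂ) :=
    (continuous_subtype_val.comp h1).matrix_trace
  exact continuous_const.mul (Real.continuous_arccos.comp
    (continuous_const.mul (Complex.continuous_re.comp h2)))

open CategoryTheory in
instance : CompactSpace (SU2Rep X) := by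
  have hind : IsInducing fun (ρ : SU2Rep X) (γ : Σ x y : FundamentalGroupoid X, (x ⟶ y)) =>
      ρ.hol γ.2.2 := ⟨rfl⟩
  rw [← isCompact_univ_iff, hind.isCompact_iff, Set.image_univ]
  refine IsClosed.isCompact ?_
  -- Inside the product of copies of SU(2) over all morphisms, representations are cut out by the
  -- functor identities, which are closed conditions.
  have : (Set.range fun (ρ : SU2Rep X) (γ : Σ x y : FundamentalGroupoid X, (x ⟶ y)) =>
      ρ.hol γ.2.2) = {F | (∀ x : FundamentalGroupoid X, F ⟨x, x, 𝟙 x⟩ = 1) ∧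
        ∀ (x y z : FundamentalGroupoid X) (f : x ⟶ y) (g : y ⟶ z),
          F ⟨x, z, f ≫ g⟩ = F ⟨y, z, g⟩ * F ⟨x, y, f⟩} := by
    ext F
    constructor
    · rintro ⟨ρ, rfl⟩
      exact ⟨fun x => CategoryTheory.Functor.map_id (D := SingleObj SU2) ρ x,
        fun x y z f g => CategoryTheory.Functor.map_comp (D := SingleObj SU2) ρ f g⟩
    · rintro ⟨h1, h2⟩
      exact ⟨{ obj := fun _ => SingleObj.star SU2
               map := fun {x y} f => F ⟨x, y, f⟩
               map_id := h1
               map_comp := fun {x y z} f g => h2 x y z f g }, rfl⟩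
  rw [this, Set.ofPred_and]
  refine IsClosed.inter ?_ ?_
  · simp only [Set.ofPred_forall]
    exact isClosed_iInter fun x => isClosed_eq (continuous_apply _) continuous_const
  · simp only [Set.ofPred_forall]
    refine isClosed_iInter fun x => isClosed_iInter fun y => isClosed_iInter fun z =>
      isClosed_iInter fun f => isClosed_iInter fun g => ?_
    exact isClosed_eq (by fun_prop) (by fun_prop)

end SU2Rep

instance : CompactSpace (ClRep X) :=
  inferInstanceAs (CompactSpace (Quotient (SU2Rep.setoid X)))

theorem ClRep.continuous_goldman {x : X} (C : Path x x) :
    Continuous (ClRep.goldman C : ClRep X → ℝ) :=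
  (SU2Rep.continuous_goldman C).quotient_lift _

end Goldman

/-! ### Trinion representations parametrised by the tetrahedron. -/

namespace Trinion

/-- The values of the Goldman functions of the boundary circles of the trinion. -/
noncomputable def boundaryCoords (ρ : SU2Rep Trinion) : Fin 3 → ℝ :=
  fun i => ρ.goldman (boundaryLoop i)

theorem boundaryCoords_rep (A C : SU2) : boundaryCoords (rep A C) =
    ![1 / Real.pi * SU2.angle (C * A), 1 / Real.pi * SU2.angle A, 1 / Real.pi * SU2.angle C] := by
  ext i
  fin_cases i
  · change (rep A C).goldman (boundaryLoop 0) = _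
    rw [SU2Rep.goldman_eq_angle, rep_along_zero, SU2.angle_inv]
    rfl
  · change (rep A C).goldman (boundaryLoop 1) = _
    rw [SU2Rep.goldman_eq_angle, rep_along_one]
    rfl
  · change (rep A C).goldman (boundaryLoop 2) = _
    rw [SU2Rep.goldman_eq_angle, rep_along_two]
    rfl

theorem exists_boundaryCoords_eq (ρ : SU2Rep Trinion) : ∃ A C h,
    SU2Rep.Intertwines ρ (rep A C) h ∧ boundaryCoords ρ = boundaryCoords (rep A C) := by
  obtain ⟨A, C, h, hh⟩ := exists_intertwines_rep ρ
  exact ⟨A, C, h, hh, funext fun i => hh.goldman_eq _⟩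

theorem boundaryCoords_mem (ρ : SU2Rep Trinion) : boundaryCoords ρ ∈ tetrahedron := by
  obtain ⟨A, C, -, -, e⟩ := exists_boundaryCoords_eq ρ
  rw [e, boundaryCoords_rep]
  have hpi := Real.pi_pos
  have hA := SU2.angle_mem A
  have hC := SU2.angle_mem C
  have hCA := SU2.angle_mem (C * A)
  obtain ⟨h1, h2, h3⟩ := SU2.angle_mul_triangle A C
  rw [abs_le] at h1
  have scale : ∀ a b : ℝ, a ≤ b → 1 / Real.pi * a ≤ 1 / Real.pi * b := fun a b h =>
    mul_le_mul_of_nonneg_left h (by positivity)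
  have hone : 1 / Real.pi * Real.pi = 1 := by field_simp
  have e1 := scale _ _ h1.1
  have e2 := scale _ _ h1.2
  have e3 := scale _ _ h2
  have e4 := scale _ _ h3
  refine ⟨fun i => ?_, ?_, ?_⟩
  · have h01 : ∀ g : SU2, 0 ≤ 1 / Real.pi * SU2.angle g ∧ 1 / Real.pi * SU2.angle g ≤ 1 :=
      fun g => ⟨by have := (SU2.angle_mem g).1; positivity,
        (scale _ _ (SU2.angle_mem g).2).trans hone.le⟩
    fin_cases i
    · exact h01 _
    · exact h01 _
    · exact h01 _
  · simp only [Matrix.cons_val]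
    rw [abs_le]
    constructor <;> linarith
  · simp only [Matrix.cons_val]
    rw [le_min_iff]
    constructor <;> linarith

theorem exists_boundaryCoords {t : Fin 3 → ℝ} (ht : t ∈ tetrahedron) :
    ∃ ρ, boundaryCoords ρ = t := by
  obtain ⟨h01, h1, h2⟩ := ht
  rw [abs_le] at h1
  rw [le_min_iff] at h2
  have hpi := Real.pi_pos
  have range : ∀ i, 0 ≤ Real.pi * t i ∧ Real.pi * t i ≤ Real.pi := fun i =>
    ⟨mul_nonneg hpi.le (h01 i).1, mul_le_of_le_one_right hpi.le (h01 i).2⟩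
  have scale : ∀ a b : ℝ, a ≤ b → Real.pi * a ≤ Real.pi * b := fun a b h =>
    mul_le_mul_of_nonneg_left h hpi.le
  have e1 := scale _ _ h1.1
  have e2 := scale _ _ h1.2
  have e3 := scale _ _ h2.1
  have e4 := scale _ _ h2.2
  obtain ⟨A, C, hA, hC, hCA⟩ := SU2.exists_angles (range 1) (range 2) (range 0)
    (abs_le.2 ⟨by linarith, by linarith⟩) (by linarith) (by linarith)
  refine ⟨rep A C, ?_⟩
  rw [boundaryCoords_rep, hA, hC, hCA]
  have hs : ∀ x : ℝ, 1 / Real.pi * (Real.pi * x) = x := fun x => by field_simp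
  rw [hs, hs, hs]
  ext i
  fin_cases i <;> rfl

/-- Reduces to model representations, whose three coordinates are the scaled angles of `C * A`, `A`,
`C`; these determine the pair up to simultaneous conjugation. -/
theorem intertwines_of_boundaryCoords_eq {ρ σ : SU2Rep Trinion}
    (h : boundaryCoords ρ = boundaryCoords σ) : ∃ k, SU2Rep.Intertwines ρ σ k := by
  obtain ⟨A, C, k, hk, e⟩ := exists_boundaryCoords_eq ρ
  obtain ⟨A', C', k', hk', e'⟩ := exists_boundaryCoords_eq σ
  rw [e, e', boundaryCoords_rep, boundaryCoords_rep] at h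
  have hpi : 1 / Real.pi ≠ 0 := (one_div_pos.2 Real.pi_pos).ne'
  have h0 := mul_left_cancel₀ hpi (congrFun h 0)
  have h1 := mul_left_cancel₀ hpi (congrFun h 1)
  have h2 := mul_left_cancel₀ hpi (congrFun h 2)
  obtain ⟨P, rfl, rfl⟩ := SU2.exists_simultaneous_conj h1 h2 h0
  exact ⟨_, (hk.trans (rep_conj A C P)).trans hk'.symm⟩

theorem circlePoint_neg (i : Fin 3) (θ : ℝ) :
    circlePoint i (-θ) = (starRingEnd ℂ) (circlePoint i θ) := by
  fin_cases i <;> simp [circlePoint, ← Complex.exp_conj, map_ofNat]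

end Trinion

/-! ### The moment polytope of `Θ`. -/

section Theta

open TrivalentGraph Trinion

theorem Trinion.conj_mem (z : Trinion) : ‖(starRingEnd ℂ) z.1‖ ≤ 4 ∧
    1 ≤ ‖(starRingEnd ℂ) z.1 - 2‖ ∧ 1 ≤ ‖(starRingEnd ℂ) z.1 + 2‖ := by
  have h2 : (starRingEnd ℂ) z.1 - 2 = (starRingEnd ℂ) (z.1 - 2) := by rw [map_sub, map_ofNat]
  have h3 : (starRingEnd ℂ) z.1 + 2 = (starRingEnd ℂ) (z.1 + 2) := by rw [map_add, map_ofNat]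
  rw [h2, h3, RCLike.norm_conj, RCLike.norm_conj, RCLike.norm_conj]
  exact z.2

/-- Complex conjugation on the trinion. -/
noncomputable def Trinion.reflect : C(Trinion, Trinion) where
  toFun z := ⟨(starRingEnd ℂ) z.1, z.conj_mem⟩
  continuous_toFun :=
    (Complex.continuous_conj.comp continuous_subtype_val : Continuous fun z : Trinion =>
      (starRingEnd ℂ) z.1).subtype_mk conj_mem

/-- The surface of the graph `Θ` is the double of the trinion; this is the fold map. -/
noncomputable def thetaFold : C(theta.Surface, Trinion) where
  toFun := Quot.lift (fun p : Σ _ : Bool, Trinion => bif p.1 then reflect p.2 else p.2) (by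
    rintro _ _ ⟨e, θ⟩
    apply Subtype.ext
    change circlePoint e θ = (starRingEnd ℂ) (circlePoint e (-θ))
    rw [circlePoint_neg, Complex.conj_conj])
  continuous_toFun := by
    refine continuous_quot_lift _ (continuous_sigma fun b => ?_)
    cases b
    · exact continuous_id
    · exact reflect.continuous

theorem theta_momentPolytope : theta.momentPolytope = tetrahedron := by
  ext t
  constructor
  · rintro ⟨⟨ρ⟩, rfl⟩
    exact boundaryCoords_mem (ρ.pullback ⟨_, theta.continuous_trinionMap false⟩)
  · intro ht
    obtain ⟨ρ, rfl⟩ := exists_boundaryCoords ht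
    -- All three meridians are drawn on the trinion `false`, where the fold is the identity.
    exact ⟨Quotient.mk _ (ρ.pullback thetaFold), rfl⟩

end Theta

/-! ### Point identifications in the glued surface. -/

section Gluing

open Topology

universe u v

namespace TrivalentGraph

open Trinion

variable {V : Type u} {E : Type v} (Γ : TrivalentGraph V E)

/-- The point with parameter `θ` on the boundary circle at the half-edge `h`. -/
noncomputable def endPoint (h : E × Bool) (θ : ℝ) : Σ _ : V, Trinion :=
  ⟨(Γ.halfEdge h).1, boundary (Γ.halfEdge h).2 θ⟩

/-- The other half of an edge. -/
def flip (h : E × Bool) : E × Bool := (h.1, !h.2)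

theorem flip_flip (h : E × Bool) : flip (flip h) = h := by simp [flip]

theorem continuous_endPoint (h : E × Bool) : Continuous (Γ.endPoint h) :=
  continuous_sigmaMk.comp (continuous_boundary _)

theorem trinionMap_boundary (h : E × Bool) (θ : ℝ) :
    Γ.trinionMap (Γ.halfEdge h).1 (boundary (Γ.halfEdge h).2 θ) =
      Γ.trinionMap (Γ.halfEdge (flip h)).1 (boundary (Γ.halfEdge (flip h)).2 (-θ)) := by
  obtain ⟨e, b⟩ := h
  cases b
  · exact Quot.sound (Glue.glue e θ)
  · have := Quot.sound (Glue.glue (Γ := Γ) e (-θ))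
    rw [neg_neg] at this
    exact this.symm

/-- The relation between two different points of the disjoint union of the trinions that are
identified in the surface. -/
def Opposite (x y : Σ _ : V, Trinion) : Prop :=
  ∃ h θ, x = Γ.endPoint h θ ∧ y = Γ.endPoint (flip h) (-θ)

theorem Opposite.symm {x y : Σ _ : V, Trinion} (h : Γ.Opposite x y) : Γ.Opposite y x := by
  obtain ⟨h, θ, rfl, rfl⟩ := h
  exact ⟨flip h, -θ, rfl, by rw [flip_flip, neg_neg]⟩

theorem circlePoint_eq_iff (i : Fin 3) (θ θ' : ℝ) : circlePoint i θ = circlePoint i θ' ↔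
    Complex.exp (θ * Complex.I) = Complex.exp (θ' * Complex.I) := by
  fin_cases i <;> simp [circlePoint, Complex.exp_neg]

/-- The boundary circles are disjoint: the inner ones have norms at most 3, below the outer radius
4, and their centres are at distance 4, more than the sum of the radii. -/
theorem circlePoint_index {i j : Fin 3} {θ θ' : ℝ} (h : circlePoint i θ = circlePoint j θ') :
    i = j := by
  have key : ∀ (i : Fin 3) (θ : ℝ), ‖circlePoint i θ - ![0, 2, -2] i‖ = ![4, 1, 1] i := by
    intro i θ
    rw [circlePoint, add_sub_cancel_left, norm_mul, Complex.norm_exp_ofReal_mul_I, mul_one]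
    fin_cases i <;> simp
  have h0 : ∀ (i : Fin 3) (θ : ℝ), i ≠ 0 → ‖circlePoint i θ‖ < 4 := by
    intro i θ hi
    have n2 : ‖(2 : ℂ)‖ = 2 := by norm_num
    have a := key i θ
    fin_cases i
    · exact absurd rfl hi
    · have := norm_sub_norm_le (circlePoint 1 θ) 2
      simp at a
      simp only [Fin.mk_one]
      linarith
    · have := norm_sub_le_norm_add (circlePoint 2 θ) 2
      simp at a
      simp only [Fin.reduceFinMk]
      linarith
  have h4 : ∀ θ, ‖circlePoint 0 θ‖ = 4 := fun θ => by simpa using key 0 θ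
  have h12 : ∀ θ θ', circlePoint 1 θ ≠ circlePoint 2 θ' := by
    intro θ θ' e
    have a := key 1 θ
    have b := key 2 θ'
    simp at a b
    rw [e] at a
    have := norm_sub_le (circlePoint 2 θ' + 2) (circlePoint 2 θ' - 2)
    rw [a, b, show circlePoint 2 θ' + 2 - (circlePoint 2 θ' - 2) = 4 by ring] at this
    norm_num at this
  by_contra hij
  by_cases hi : i = 0
  · subst hi
    have := h0 j θ' (Ne.symm hij)
    rw [← h, h4] at this
    exact lt_irrefl _ this
  by_cases hj : j = 0
  · subst hj
    have := h0 i θ hi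
    rw [h, h4] at this
    exact lt_irrefl _ this
  fin_cases i <;> fin_cases j <;> simp at hij hi hj
  · exact h12 _ _ h
  · exact h12 _ _ h.symm

theorem endPoint_eq_endPoint {h k : E × Bool} {θ θ' : ℝ}
    (e : Γ.endPoint h θ = Γ.endPoint k θ') :
    h = k ∧ Complex.exp (θ * Complex.I) = Complex.exp (θ' * Complex.I) := by
  have e1 : (Γ.halfEdge h).1 = (Γ.halfEdge k).1 := congrArg Sigma.fst e
  have e2 : circlePoint (Γ.halfEdge h).2 θ = circlePoint (Γ.halfEdge k).2 θ' :=
    congrArg (fun p : Σ _ : V, Trinion => p.2.1) e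
  have e3 := circlePoint_index e2
  rw [e3, circlePoint_eq_iff] at e2
  exact ⟨Γ.halfEdge.injective (Prod.ext e1 e3), e2⟩

/-- A boundary point lies on one circle only and its parameter is unique modulo `2 π`, so it has a
single partner. -/
theorem Opposite.eq_of_opposite {x y z : Σ _ : V, Trinion} (h1 : Γ.Opposite x y)
    (h2 : Γ.Opposite y z) : x = z := by
  obtain ⟨h, θ, rfl, e1⟩ := h1
  obtain ⟨k, θ', e2, rfl⟩ := h2
  obtain ⟨rfl, e⟩ := Γ.endPoint_eq_endPoint (e1.symm.trans e2)
  rw [flip_flip]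
  refine Sigma.ext rfl (heq_of_eq (Subtype.ext ?_))
  refine (circlePoint_eq_iff _ _ _).2 ?_
  rw [Complex.ofReal_neg, neg_mul, Complex.exp_neg] at e ⊢
  rw [← e, inv_inv]

/-- Since partners are unique, the equivalence relation generated by the gluing adds only equality
and symmetry. -/
theorem mk_eq_mk_iff (x y : Σ _ : V, Trinion) :
    Quot.mk Γ.Glue x = Quot.mk Γ.Glue y ↔ x = y ∨ Γ.Opposite x y := by
  constructor
  · intro h
    have h' := Quot.eqvGen_exact h
    clear h
    induction h' with
    | rel x y h =>
      obtain ⟨e, θ⟩ := h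
      exact Or.inr ⟨(e, false), θ, rfl, rfl⟩
    | refl x => exact Or.inl rfl
    | symm x y _ ih =>
      rcases ih with rfl | h
      · exact Or.inl rfl
      · exact Or.inr h.symm
    | trans x y z _ _ ih1 ih2 =>
      rcases ih1 with rfl | h1
      · exact ih2
      · rcases ih2 with rfl | h2
        · exact Or.inr h1
        · exact Or.inl (h1.eq_of_opposite Γ h2)
  · rintro (rfl | ⟨h, θ, rfl, rfl⟩)
    · rfl
    · exact Γ.trinionMap_boundary h θ

instance : CompactSpace Trinion := by
  have h : {z : ℂ | ‖z‖ ≤ 4 ∧ 1 ≤ ‖z - 2‖ ∧ 1 ≤ ‖z + 2‖} ⊆ Metric.closedBall 0 4 := by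
    intro z hz
    simpa using hz.1
  refine isCompact_iff_compactSpace.1 ((isCompact_closedBall (0 : ℂ) 4).of_isClosed_subset ?_ h)
  have h1 : IsClosed {z : ℂ | ‖z‖ ≤ 4} := isClosed_le (by fun_prop) continuous_const
  have h2 : IsClosed {z : ℂ | 1 ≤ ‖z - 2‖} := isClosed_le continuous_const (by fun_prop)
  have h3 : IsClosed {z : ℂ | 1 ≤ ‖z + 2‖} := isClosed_le continuous_const (by fun_prop)
  exact h1.inter (h2.inter h3)

instance : T2Space Trinion :=
  inferInstanceAs (T2Space {z : ℂ // ‖z‖ ≤ 4 ∧ 1 ≤ ‖z - 2‖ ∧ 1 ≤ ‖z + 2‖})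

/-- The saturation of a closed `F` is `F` together with, for each of the finitely many half-edges,
the partners of its points on that circle; the latter sets are compact. -/
theorem isClosedMap_mk [Finite V] [Finite E] :
    IsClosedMap (Quot.mk Γ.Glue : (Σ _ : V, Trinion) → Γ.Surface) := by
  intro F hF
  have hpre : (Quot.mk Γ.Glue : (Σ _ : V, Trinion) → Γ.Surface) ⁻¹' (Quot.mk Γ.Glue '' F) =
      F ∪ ⋃ h : E × Bool, Prod.snd '' (Set.range (fun θ : ℝ =>
        (Γ.endPoint h θ, Γ.endPoint (flip h) (-θ))) ∩ Prod.fst ⁻¹' F) := by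
    ext y
    simp only [Set.mem_preimage, Set.mem_image, Set.mem_union, Set.mem_iUnion]
    constructor
    · rintro ⟨x, hx, e⟩
      rcases (Γ.mk_eq_mk_iff x y).1 e with rfl | ⟨h, θ, rfl, rfl⟩
      · exact Or.inl hx
      · exact Or.inr ⟨h, _, ⟨⟨θ, rfl⟩, hx⟩, rfl⟩
    · rintro (h | ⟨h, _, ⟨⟨θ, rfl⟩, hx⟩, rfl⟩)
      · exact ⟨y, h, rfl⟩
      · exact ⟨_, hx, (Γ.mk_eq_mk_iff _ _).2 (Or.inr ⟨h, θ, rfl, rfl⟩)⟩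
  refine isQuotientMap_quot_mk.isClosed_preimage.1 ?_
  rw [hpre]
  refine hF.union (isClosed_iUnion_of_finite fun h => ?_)
  refine IsCompact.isClosed (IsCompact.image ?_ continuous_snd)
  refine IsCompact.inter_right ?_ (hF.preimage continuous_fst)
  refine Function.Periodic.compact_of_continuous (c := 2 * Real.pi) ?_
    (by positivity) ((Γ.continuous_endPoint h).prodMk
      ((Γ.continuous_endPoint _).comp continuous_neg))
  have hper : ∀ (k : E × Bool) (θ θ' : ℝ), Complex.exp (θ * Complex.I) = Complex.exp (θ' * Complex.I) →
      Γ.endPoint k θ = Γ.endPoint k θ' := fun k θ θ' e =>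
    Sigma.ext rfl (heq_of_eq (Subtype.ext ((circlePoint_eq_iff _ _ _).2 e)))
  intro θ
  have e : Complex.exp (((θ + 2 * Real.pi : ℝ) : ℂ) * Complex.I) =
      Complex.exp (θ * Complex.I) := by
    push_cast
    rw [add_mul, Complex.exp_add, Complex.exp_two_pi_mul_I, mul_one]
  refine Prod.ext (hper _ _ _ e) (hper _ _ _ ?_)
  rw [Complex.ofReal_neg, neg_mul, Complex.exp_neg, e, Complex.ofReal_neg, neg_mul,
    Complex.exp_neg]

/-- All circles `C_e` and boundary circles of trinions at `e` have the same Goldman function. -/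
theorem goldman_meridian (ρ : SU2Rep Γ.Surface) (v : V) (i : Fin 3) :
    ρ.goldman (Γ.meridian (Γ.edge v i)) =
      ρ.goldman ((boundaryLoop i).map (Γ.continuous_trinionMap v)) := by
  have key : ∀ (h : E × Bool) (v : V) (i : Fin 3), Γ.halfEdge h = (v, i) →
      ρ.goldman (Γ.meridian h.1) =
        ρ.goldman ((boundaryLoop i).map (Γ.continuous_trinionMap v)) := by
    rintro ⟨e, b⟩ v i hv
    obtain ⟨rfl, rfl⟩ := Prod.ext_iff.1 hv
    cases b
    · rfl
    · have h0 := Γ.trinionMap_boundary (e, true) 0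
      rw [neg_zero] at h0
      -- Seen from the other end of the edge the circle is traversed backwards, which inverts the
      -- holonomy and preserves the Goldman function.
      refine (SU2Rep.goldman_symm _ ρ).symm.trans
        ((SU2Rep.goldman_cast (Γ.meridian e).symm h0 ρ).symm.trans ?_)
      congr 1
      ext t
      have ht := Γ.trinionMap_boundary (e, true) (2 * Real.pi * t)
      refine Eq.trans ?_ ht.symm
      change Γ.trinionMap _ (boundary _ (2 * Real.pi * (1 - t))) = _
      congr 1
      refine Subtype.ext ((circlePoint_eq_iff _ _ _).2 ?_)
      rw [show 2 * Real.pi * (1 - (t : ℝ)) = -(2 * Real.pi * t) + 2 * Real.pi by ring,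
        Complex.ofReal_add, add_mul, Complex.exp_add]
      push_cast
      rw [Complex.exp_two_pi_mul_I, mul_one]
  exact key (Γ.halfEdge.symm (v, i)) v i (Γ.halfEdge.apply_symm_apply _)

end TrivalentGraph

end Gluing

/-! ### Representations of disjoint unions of trinions. -/

section SigmaTrinion

open Topology

universe u

variable {ι : Type u}

/-- The inclusion of a trinion in a disjoint union of trinions. -/
def trinionIncl (i : ι) : C(Trinion, Σ _ : ι, Trinion) where
  toFun z := ⟨i, z⟩
  continuous_toFun := continuous_sigmaMk (σ := fun _ : ι => Trinion)

/-- The projection of a disjoint union of trinions to the trinion. -/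
def trinionProj : C((Σ _ : ι, Trinion), Trinion) where
  toFun x := x.2
  continuous_toFun := continuous_sigma fun _ => continuous_id

theorem sigma_path_induction {P : ∀ x y : Σ _ : ι, Trinion, Path x y → Prop}
    (h : ∀ i x y (γ : Path x y), P _ _ (γ.map (trinionIncl i).continuous))
    {x y : Σ _ : ι, Trinion} (γ : Path x y) : P x y γ := by
  obtain ⟨i, g, hg⟩ := ContinuousMap.exists_lift_sigma (γ : C(unitInterval, Σ _ : ι, Trinion))
  have hγ : ∀ t, γ t = ⟨i, g t⟩ := fun t => DFunLike.congr_fun hg t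
  obtain rfl : x = ⟨i, g 0⟩ := by rw [← hγ, γ.source]
  obtain rfl : y = ⟨i, g 1⟩ := by rw [← hγ, γ.target]
  have e : (Path.mk g rfl rfl : Path (g 0) (g 1)).map (trinionIncl i).continuous = γ := by
    ext1
    funext t
    exact (hγ t).symm
  exact e ▸ h i _ _ (Path.mk g rfl rfl : Path (g 0) (g 1))

theorem exists_intertwines_sigma (ρ σ : SU2Rep (Σ _ : ι, Trinion))
    (h : ∀ i, ∃ k, SU2Rep.Intertwines (ρ.pullback (trinionIncl i)) (σ.pullback (trinionIncl i)) k) :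
    ∃ k, SU2Rep.Intertwines ρ σ k := by
  choose k hk using h
  exact ⟨fun x => k x.1 x.2, fun x y γ => sigma_path_induction
    (P := fun x y γ => k y.1 y.2 * ρ.along γ = σ.along γ * k x.1 x.2) (fun i x y γ => hk i γ) γ⟩

theorem exists_sigma_rep (ρ : ι → SU2Rep Trinion) : ∃ σ : SU2Rep (Σ _ : ι, Trinion),
    ∀ i ⦃x y : Trinion⦄ (γ : Path x y), (σ.pullback (trinionIncl i)).along γ = (ρ i).along γ := by
  refine ⟨SU2Rep.ofPaths
    (fun {x y} γ => (ρ x.1).along (γ.map trinionProj.continuous)) ?_ ?_ ?_, ?_⟩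
  · intro x y γ δ h
    exact SU2Rep.along_congr _ (h.map trinionProj)
  · intro x
    exact SU2Rep.along_refl _ _
  · intro x y z γ δ
    -- A path stays in one summand, so the representation chosen by its starting point is also the
    -- one chosen by its end point.
    have hxy : x.1 = y.1 := sigma_path_induction (P := fun x y _ => x.1 = y.1)
      (fun i x y γ => rfl) γ
    rw [Path.map_trans, SU2Rep.along_trans, hxy]
  · intro i x y γ
    rfl

end SigmaTrinion

/-! ### Hyperbolic graphs and the half surface. -/

section HalfSurface

open Topology

universe u v

namespace TrivalentGraph

variable {V : Type u} {E : Type v} (Γ : TrivalentGraph V E)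

/-- On the indicator vector of `S` the form is the sum of the nonnegative entries indexed by `S ×
S`. It vanishes, so each entry does, whereas an edge inside `S` would make one positive. -/
theorem IsIsotropic.not_endpoints_mem [Fintype V] [Finite E] {S : Set V} (hS : Γ.IsIsotropic S)
    (e : E) : ¬ (Γ.endpoint (e, false) ∈ S ∧ Γ.endpoint (e, true) ∈ S) := by
  classical
  rintro ⟨h0, h1⟩
  have h := hS (fun v => if v ∈ S then 1 else 0) (fun v hv => if_neg hv)
  have nonneg : ∀ v w, 0 ≤ Γ.incidence v w := fun v w => Int.natCast_nonneg _
  have hrow : ∀ v, 0 ≤ Matrix.mulVec Γ.incidence (fun v => if v ∈ S then 1 else 0) v := fun v =>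
    Finset.sum_nonneg fun w _ => mul_nonneg (nonneg v w) (by positivity)
  rw [dotProduct, Finset.sum_eq_zero_iff_of_nonneg
    (fun v _ => mul_nonneg (by positivity) (hrow v))] at h
  have h2 := h (Γ.endpoint (e, false)) (Finset.mem_univ _)
  rw [if_pos h0, one_mul, Matrix.mulVec, dotProduct, Finset.sum_eq_zero_iff_of_nonneg
    (fun w _ => mul_nonneg (nonneg _ w) (by positivity))] at h2
  have h3 := h2 (Γ.endpoint (e, true)) (Finset.mem_univ _)
  rw [if_pos h1, mul_one] at h3
  have h4 : Set.ncard {e' : E | s(Γ.endpoint (e', false), Γ.endpoint (e', true)) =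
      s(Γ.endpoint (e, false), Γ.endpoint (e, true))} = 0 := Int.natCast_eq_zero.1 h3
  rw [Set.ncard_eq_zero (Set.toFinite _)] at h4
  exact Set.notMem_empty e (h4 ▸ (rfl : s(Γ.endpoint (e, false), Γ.endpoint (e, true)) = _))

/-- No edge has both end points in `S`. -/
def IsIndependent (S : Set V) : Prop :=
  ∀ e, ¬ (Γ.endpoint (e, false) ∈ S ∧ Γ.endpoint (e, true) ∈ S)

theorem IsIndependent.not_mem_flip {S : Set V} (hS : Γ.IsIndependent S) (h : E × Bool)
    (h0 : Γ.endpoint h ∈ S) : Γ.endpoint (flip h) ∉ S := by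
  obtain ⟨e, b⟩ := h
  cases b
  · exact fun h1 => hS e ⟨h0, h1⟩
  · exact fun h1 => hS e ⟨h1, h0⟩

/-- Injectivity says that no edge has both ends in `S`; surjectivity, that none has both ends in the
complement `T`. -/
theorem edge_bijective {S T : Set V} (hST : IsCompl S T) (hS : Γ.IsIndependent S)
    (hT : Γ.IsIndependent T) :
    Function.Bijective (fun p : S × Fin 3 => Γ.edge p.1 p.2) := by
  constructor
  · rintro ⟨⟨v, hv⟩, i⟩ ⟨⟨w, hw⟩, j⟩ e
    obtain ⟨h, hh⟩ : ∃ h, h = Γ.halfEdge.symm (v, i) := ⟨_, rfl⟩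
    obtain ⟨k, hk⟩ : ∃ k, k = Γ.halfEdge.symm (w, j) := ⟨_, rfl⟩
    have e' : h.1 = k.1 := by rw [hh, hk]; exact e
    have hv' : Γ.halfEdge h = (v, i) := by rw [hh, Equiv.apply_symm_apply]
    have hw' : Γ.halfEdge k = (w, j) := by rw [hk, Equiv.apply_symm_apply]
    have hSv : Γ.endpoint h ∈ S := by rw [endpoint, hv']; exact hv
    have hSw : Γ.endpoint k ∈ S := by rw [endpoint, hw']; exact hw
    by_cases hb : h.2 = k.2
    · have : h = k := Prod.ext e' hb
      rw [this, hw'] at hv'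
      obtain ⟨rfl, rfl⟩ := Prod.ext_iff.1 hv'
      rfl
    · have : k = flip h := Prod.ext e'.symm (Bool.eq_not.2 (Ne.symm hb))
      exact absurd hSw (this ▸ hS.not_mem_flip Γ h hSv)
  · intro e
    have key : ∀ h : E × Bool, Γ.endpoint h ∈ S → ∃ p : S × Fin 3, Γ.edge p.1 p.2 = h.1 :=
      fun h hh => ⟨(⟨_, hh⟩, (Γ.halfEdge h).2),
        congrArg Prod.fst (Γ.halfEdge.symm_apply_apply h)⟩
    by_cases h0 : Γ.endpoint (e, false) ∈ S
    · exact key _ h0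
    · have h0' : Γ.endpoint (e, false) ∈ T := by
        rw [← hST.compl_eq]
        exact h0
      have h1 : Γ.endpoint (e, true) ∉ T := fun h => hT e ⟨h0', h⟩
      have h1' : Γ.endpoint (e, true) ∈ S := by
        rw [← hST.symm.compl_eq]
        exact h1
      exact key _ h1'

theorem halfTrinionMap_injective {S : Set V} (hS : Γ.IsIndependent S) {v w : S} {z z' : Trinion}
    (h : Γ.halfTrinionMap S v z = Γ.halfTrinionMap S w z') : v = w ∧ z = z' := by
  have h' : Quot.mk Γ.Glue ⟨v, z⟩ = Quot.mk Γ.Glue ⟨w, z'⟩ := congrArg Subtype.val h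
  rcases (Γ.mk_eq_mk_iff _ _).1 h' with e | ⟨k, θ, e1, e2⟩
  · have e1 := congrArg Sigma.fst e
    have e2 := congrArg (fun p : Σ _ : V, Trinion => p.2) e
    exact ⟨Subtype.ext e1, e2⟩
  · have h1 : (v : V) = Γ.endpoint k := congrArg Sigma.fst e1
    have h2 : (w : V) = Γ.endpoint (flip k) := congrArg Sigma.fst e2
    exact absurd (h2 ▸ w.2) (hS.not_mem_flip Γ k (h1 ▸ v.2))

/-- The half surface of an independent set of vertices is a disjoint union of trinions. -/
theorem exists_halfSurface_homeomorph [Finite V] [Finite E] {S : Set V} (hS : Γ.IsIndependent S) :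
    ∃ φ : (Σ _ : S, Trinion) ≃ₜ Γ.halfSurface S, ∀ p, φ p = Γ.halfTrinionMap S p.1 p.2 := by
  let f : (Σ _ : S, Trinion) → Γ.halfSurface S := fun p => Γ.halfTrinionMap S p.1 p.2
  have hcont : Continuous f := continuous_sigma fun v => Γ.continuous_halfTrinionMap S v
  have hbij : Function.Bijective f := by
    constructor
    · rintro ⟨v, z⟩ ⟨w, z'⟩ h
      obtain ⟨rfl, rfl⟩ := Γ.halfTrinionMap_injective hS h
      rfl
    · rintro ⟨x, hx⟩
      obtain ⟨v, hv, z, rfl⟩ := Set.mem_iUnion₂.1 hx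
      exact ⟨⟨⟨v, hv⟩, z⟩, rfl⟩
  have hclosed : IsClosedMap f := by
    intro F hF
    let g : (Σ _ : S, Trinion) → Σ _ : V, Trinion := fun p => ⟨p.1, p.2⟩
    have hg : Continuous g := continuous_sigma fun v =>
      continuous_sigmaMk (σ := fun _ : V => Trinion) (i := (v : V))
    -- `F` is compact, being closed in a finite union of compact trinions, so its image under `g` is
    -- closed.
    have h1 : IsClosed (Quot.mk Γ.Glue '' (g '' F)) :=
      Γ.isClosedMap_mk _ (hF.isCompact.image hg).isClosed
    have h2 : f '' F = Subtype.val ⁻¹' (Quot.mk Γ.Glue '' (g '' F)) := by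
      ext x
      constructor
      · rintro ⟨p, hp, rfl⟩
        exact ⟨_, ⟨p, hp, rfl⟩, rfl⟩
      · rintro ⟨_, ⟨p, hp, rfl⟩, e⟩
        exact ⟨p, hp, Subtype.ext e⟩
    rw [h2]
    exact h1.preimage continuous_subtype_val
  exact ⟨(Equiv.ofBijective f hbij).toHomeomorphOfContinuousClosed hcont hclosed, fun p => rfl⟩

theorem continuous_boundaryHolonomy (S : Set V) : Continuous (Γ.boundaryHolonomy S) :=
  continuous_pi fun _ => continuous_pi fun _ => ClRep.continuous_goldman _

theorem boundaryHolonomy_mk (S : Set V) (ρ : SU2Rep (Γ.halfSurface S)) (v : S) :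
    Γ.boundaryHolonomy S (Quotient.mk _ ρ) v =
      Trinion.boundaryCoords (ρ.pullback ⟨_, Γ.continuous_halfTrinionMap S v⟩) := rfl

/-- On a disjoint union of trinions the gauge transformations can be chosen on each piece
separately, and each piece is governed by its three boundary angles. -/
theorem boundaryHolonomy_injective [Finite V] [Finite E] {S : Set V} (hS : Γ.IsIndependent S) :
    Function.Injective (Γ.boundaryHolonomy S) := by
  rintro ⟨ρ⟩ ⟨τ⟩ h
  obtain ⟨φ, hφ⟩ := Γ.exists_halfSurface_homeomorph hS
  let f : C((Σ _ : S, Trinion), Γ.halfSurface S) := φ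
  let g : C(Γ.halfSurface S, (Σ _ : S, Trinion)) := φ.symm
  have hf : ∀ v : S, f.comp (trinionIncl v) = ⟨_, Γ.continuous_halfTrinionMap S v⟩ := fun v =>
    ContinuousMap.ext fun z => hφ ⟨v, z⟩
  obtain ⟨k, hk⟩ := exists_intertwines_sigma (ρ.pullback f) (τ.pullback f) fun v => by
    have e := congrFun h v
    change Γ.boundaryHolonomy S (Quotient.mk _ ρ) v = Γ.boundaryHolonomy S (Quotient.mk _ τ) v at e
    rw [boundaryHolonomy_mk, boundaryHolonomy_mk, ← hf] at e
    exact Trinion.intertwines_of_boundaryCoords_eq e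
  exact (SU2Rep.mk_eq_iff ρ τ).2 ⟨_, ((SU2Rep.intertwines_pullback_of_leftInverse f g φ.apply_symm_apply ρ).trans
    (hk.pullback g)).trans
      (SU2Rep.intertwines_pullback_of_leftInverse f g φ.apply_symm_apply τ).symm⟩

theorem range_boundaryHolonomy [Finite V] [Finite E] {S : Set V} (hS : Γ.IsIndependent S) :
    Set.range (Γ.boundaryHolonomy S) = thetaProduct S := by
  have hprod : thetaProduct S = Set.pi Set.univ fun _ => tetrahedron := by
    rw [thetaProduct, theta_momentPolytope]
  rw [hprod]
  ext t
  constructor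
  · rintro ⟨⟨ρ⟩, rfl⟩ v -
    exact Trinion.boundaryCoords_mem (ρ.pullback ⟨_, Γ.continuous_halfTrinionMap S v⟩)
  · intro ht
    choose ρ hρ using fun v : S => Trinion.exists_boundaryCoords (ht v trivial)
    obtain ⟨τ, hτ⟩ := exists_sigma_rep ρ
    obtain ⟨φ, hφ⟩ := Γ.exists_halfSurface_homeomorph hS
    let f : C((Σ _ : S, Trinion), Γ.halfSurface S) := φ
    let g : C(Γ.halfSurface S, (Σ _ : S, Trinion)) := φ.symm
    refine ⟨Quotient.mk _ (τ.pullback g), funext fun v => ?_⟩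
    have hf : f.comp (trinionIncl v) = ⟨_, Γ.continuous_halfTrinionMap S v⟩ :=
      ContinuousMap.ext fun z => hφ ⟨v, z⟩
    rw [boundaryHolonomy_mk, ← hf, ← hρ v]
    funext i
    have h1 := ((SU2Rep.intertwines_pullback_of_leftInverse g f φ.symm_apply_apply τ).pullback
      (trinionIncl v)).goldman_eq (Trinion.boundaryLoop i)
    refine h1.symm.trans ?_
    rw [SU2Rep.goldman_eq_angle, hτ]
    rfl

/-- The preimage is the restriction of `ρ` to the half surface. Since `goldman_meridian` compares
the circles inside the whole surface, no condition on `S` enters. -/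
theorem groupCoords_momentMap_mem (S : Set V) (ρ : ClRep Γ.Surface) :
    Γ.groupCoords S (Γ.momentMap ρ) ∈ Set.range (Γ.boundaryHolonomy S) := by
  obtain ⟨ρ⟩ := ρ
  refine ⟨Quotient.mk _ (ρ.pullback ⟨Subtype.val, continuous_subtype_val⟩), ?_⟩
  funext v i
  exact (Γ.goldman_meridian ρ v i).symm

theorem exists_boundaryHolonomy_homeomorph [Finite V] [Finite E] {S : Set V}
    (hS : Γ.IsIndependent S) : ∃ φ : ClRep (Γ.halfSurface S) ≃ₜ thetaProduct S,
      ∀ ρ, (φ ρ : S → Fin 3 → ℝ) = Γ.boundaryHolonomy S ρ := by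
  have hmem : ∀ ρ, Γ.boundaryHolonomy S ρ ∈ thetaProduct S := fun ρ =>
    Γ.range_boundaryHolonomy hS ▸ Set.mem_range_self ρ
  have hbij : Function.Bijective fun ρ => (⟨Γ.boundaryHolonomy S ρ, hmem ρ⟩ : thetaProduct S) := by
    constructor
    · intro ρ τ h
      exact Γ.boundaryHolonomy_injective hS (congrArg Subtype.val h)
    · rintro ⟨t, ht⟩
      rw [← Γ.range_boundaryHolonomy hS] at ht
      obtain ⟨ρ, rfl⟩ := ht
      exact ⟨ρ, rfl⟩
  have hcont : Continuous (Equiv.ofBijective _ hbij) :=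
    (Γ.continuous_boundaryHolonomy S).subtype_mk hmem
  exact ⟨hcont.homeoOfEquivCompactToT2, fun ρ => rfl⟩

/-- Counting edges from either side gives `3 |S| = |E| = 3 |T|`, while `|S| + |T| = 2 g - 2`. -/
theorem IsHyperbolic.ncard_eq [Fintype V] [Finite E] {S T : Set V} (h : Γ.IsHyperbolic S T) {g : ℕ}
    (hg : Fintype.card V + 2 = 2 * g) : S.ncard = g - 1 := by
  have hS : Γ.IsIndependent S := fun e => h.isotropic_plus.not_endpoints_mem Γ e
  have hT : Γ.IsIndependent T := fun e => h.isotropic_minus.not_endpoints_mem Γ e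
  have cS := Nat.card_congr (Equiv.ofBijective _ (Γ.edge_bijective h.isCompl hS hT))
  have cT := Nat.card_congr (Equiv.ofBijective _ (Γ.edge_bijective h.isCompl.symm hT hS))
  rw [Nat.card_prod, Nat.card_coe_set_eq, Nat.card_fin] at cS cT
  have hsum := Set.ncard_add_ncard_compl S
  rw [h.isCompl.compl_eq, Nat.card_eq_fintype_card] at hsum
  omega

end TrivalentGraph

end HalfSurface

theorem mainTheorem7 {V E : Type*} [Fintype V] [Fintype E] (Γ : TrivalentGraph V E)
    (Vplus Vminus : Set V) (hΓ : Γ.IsHyperbolic Vplus Vminus)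
    (g : ℕ) (hg : Fintype.card V + 2 = 2 * g) :
    TrivalentGraph.theta.momentPolytope = tetrahedron ∧
    Vplus.ncard = g - 1 ∧
    Function.Bijective (fun p : Vplus × Fin 3 => Γ.edge p.1 p.2) ∧
    (∃ φ : ClRep (Γ.halfSurface Vplus) ≃ₜ thetaProduct Vplus,
      ∀ ρ, (φ ρ : Vplus → Fin 3 → ℝ) = Γ.boundaryHolonomy Vplus ρ) ∧
    Γ.groupCoords Vplus '' Γ.momentPolytope ⊆ Set.range (Γ.boundaryHolonomy Vplus) ∧
    Γ.groupCoords Vplus '' Γ.momentPolytope ⊆ thetaProduct Vplus := by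
  have hp : Γ.IsIndependent Vplus := fun e => hΓ.isotropic_plus.not_endpoints_mem Γ e
  have hm : Γ.IsIndependent Vminus := fun e => hΓ.isotropic_minus.not_endpoints_mem Γ e
  have himage : Γ.groupCoords Vplus '' Γ.momentPolytope ⊆
      Set.range (Γ.boundaryHolonomy Vplus) := by
    rintro _ ⟨_, ⟨ρ, rfl⟩, rfl⟩
    exact Γ.groupCoords_momentMap_mem Vplus ρ
  exact ⟨theta_momentPolytope, hΓ.ncard_eq Γ hg, Γ.edge_bijective hΓ.isCompl hp hm,
    Γ.exists_boundaryHolonomy_homeomorph hp, himage,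
    himage.trans (Γ.range_boundaryHolonomy hp).subset⟩
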